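/- There are $n\ge 1$ bins, initially empty; rounds are numbered $t=0,1,2,\dots$. Let $x^t\in\mathbb{Z}_{\ge 0}^n$ be the load vector after $t$ rounds, $W^t=\sum_{i=1}^n x_i^t$ the total number of balls, and $\mathrm{Gap}(t)=\max_{i} x_i^t-\frac{W^t}{n}$. In round $t$ (with fresh, independent randomness in every round): - **Mean-Thinning**: sample two bins $i_1,i_2$ independently and uniformly at random; add one ball to $i_1$ if $x_{i_1}^t<\frac tn$, and otherwise add one ball to $i_2$. - **Twinning**: sample one bin $i$ uniformly at random; add two balls to $i$ if $x_i^t<\frac{W^t}{n}$, and otherwise add one ball to $i$. - **$(1+\beta)$-process**: with probability $\beta$ sample two bins independently and uniformly at random and add one ball to the less loaded of the two (ties are broken in favour of the higher index); otherwise add one ball to a single bin sampled uniformly at random. **Corollary.** Consider Mean-Thinning, Twinning, or the $(1+\beta)$-process with a constant $\beta\in(0,1)$. Each of these processes has a gap of order $\Theta(\log n)$ in the heavily loaded case, in the following sense. 1. (Lower bound) There is a constant $\kappa>0$, depending only on the process, such that for all sufficiently large $n$ $$\Pr\big[\mathrm{Gap}(\lfloor\kappa\, n\log n\rfloor)\ \ge\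 \kappa\log n\big]\ \ge\ 1-n^{-1}.$$ 2. (Upper bound) There is a constant $K>0$, depending only on the process, such that for all sufficiently large $n$ and every round $m\ge 0$ $$\Pr\big[\mathrm{Gap}(m)\ \le\ K\log n\big]\ \ge\ 1-n^{-4}.$$ -/

import Mathlib

open scoped NNReal

noncomputable section

namespace BallsBins

/-- A load vector of `n` bins: the number of balls in each bin. -/
abbrev Load (n : ℕ) : Type := Fin n → ℕ

/-- The total number `W` of balls. -/
def totalLoad {n : ℕ} (x : Load n) : ℕ := ∑ i, x i

/-- The gap: maximum load minus mean load. -/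
def gap {n : ℕ} [NeZero n] (x : Load n) : ℝ :=
  ((Finset.univ.sup' Finset.univ_nonempty x : ℕ) : ℝ) - (totalLoad x : ℝ) / (n : ℝ)

/-- Put `w` additional balls into bin `i`. -/
def addBalls {n : ℕ} (x : Load n) (i : Fin n) (w : ℕ) : Load n :=
  Function.update x i (x i + w)

/-- An allocation process, given for every number `n ≥ 1` of bins by its transition
probabilities: `Q n t x` is the law of the load vector after round `t`
if the load vector before round `t` is `x` (rounds are numbered from `0`). -/
abbrev AllocProcess : Type := ∀ (n : ℕ) [NeZero n], ℕ → Load n → PMF (Load n)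

/-- The law of the load vector after `t` allocations, starting with empty bins. -/
def loadLaw (Q : AllocProcess) (n : ℕ) [NeZero n] : ℕ → PMF (Load n)
  | 0 => PMF.pure 0
  | t + 1 => (loadLaw Q n t).bind (Q n t)

/-- A uniform bin sample. -/
def sample (n : ℕ) [NeZero n] : PMF (Fin n) := PMF.uniformOfFintype (Fin n)

/-- Mean-Thinning: sample bins `i₁`, `i₂` independently and uniformly; in round `t` allocate one
ball to `i₁` if its load is below the mean load `t / n`, and to `i₂` otherwise. -/
def meanThinning : AllocProcess := fun n _ t x =>
  (sample n).bind fun i₁ => (sample n).bind fun i₂ =>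
    PMF.pure (if (x i₁ : ℝ) < (t : ℝ) / (n : ℝ) then addBalls x i₁ 1 else addBalls x i₂ 1)

/-- Twinning: sample one uniform bin; allocate two balls to it if its load is below the mean load,
and one ball otherwise. -/
def twinning : AllocProcess := fun n _ _ x =>
  (sample n).bind fun i =>
    PMF.pure (if (x i : ℝ) < (totalLoad x : ℝ) / (n : ℝ) then addBalls x i 2 else addBalls x i 1)

/-- One-Choice: allocate one ball to a uniform bin. -/
def oneChoice : AllocProcess := fun n _ _ x =>
  (sample n).bind fun i => PMF.pure (addBalls x i 1)

/-- The less loaded of two bins; ties are broken in favour of the higher index. -/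
def lighter {n : ℕ} (x : Load n) (i₁ i₂ : Fin n) : Fin n :=
  if x i₁ < x i₂ then i₁ else if x i₂ < x i₁ then i₂ else max i₁ i₂

/-- Two-Choice: sample two bins independently and uniformly, and allocate one ball to the less
loaded one. -/
def twoChoice : AllocProcess := fun n _ _ x =>
  (sample n).bind fun i₁ => (sample n).bind fun i₂ => PMF.pure (addBalls x (lighter x i₁ i₂) 1)

/-- A coin that shows `true` with probability `β`. -/
def coin (β : ℝ≥0) (hβ : β ≤ 1) : PMF Bool :=
  PMF.ofFintype (fun b => if b then (β : ENNReal) else ((1 - β : ℝ≥0) : ENNReal)) (by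
    simp only [Fintype.sum_bool, if_true, Bool.false_eq_true, if_false]
    rw [← ENNReal.coe_add, add_tsub_cancel_of_le hβ, ENNReal.coe_one])

/-- The `(1+β)`-process: with probability `β` allocate by Two-Choice, otherwise by One-Choice. -/
def onePlusBeta (β : ℝ≥0) (hβ : β ≤ 1) : AllocProcess := fun n _ t x =>
  (coin β hβ).bind fun b => if b then twoChoice n t x else oneChoice n t x

/-- The probability that the gap after `m` allocations into `n` initially empty bins
satisfies `S`. -/
def gapProb (Q : AllocProcess) (n : ℕ) [NeZero n] (m : ℕ) (S : ℝ → Prop) : ℝ :=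
  (loadLaw Q n m).toMeasure.real {x | S (gap x)}

end BallsBins

end

/-! Each process is a Markov chain that adds `w x i` balls to bin `i` with probability `p x i`.
Expectations after `m` rounds are `m`-fold iterates of the averaging operator `stepOp`, so
everything reduces to one-step drift inequalities.

Upper bound. Let Φ_a be the sum of exp(a · deviation) over the bins. The goal is a Lyapunov function
V, exponential in the largest deviation, that contracts by a factor 1 - c/n whenever Φ_α or Φ_{-α}
is at least 2n; then the expectation of V stays polynomial in n and Markov's inequality gives the
tail. In Mean-Thinning and Twinning, with δ the fraction of overloaded bins, overloaded bins drift
by -(1-δ)/n and underloaded ones by δ/n (`MeanBiased`). If δ is bounded away from 0 and 1, Φ_α and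
Φ_{-α} both contract when large. If δ is extreme, the majority side has almost no drift, but one of
two things helps (`expPot_large_or_many_close`): either the few bins on the other side are far away,
so that a potential with a larger exponent γ is large and contracts, or half of the bins are near
the mean, so that random fluctuation makes a Huber potential grow. V is a geometric mean of the four
exponential potentials and the exponential of minus the Huber potential; convexity of exp adds up
the separate drifts (`stepOp_exp_logPot_le`). For the (1+β)-process the drift of Φ_a is minus the
mean absolute difference of its summands, up to a factor, and the summands of Φ_α and Φ_{-α} cannot
both be concentrated when one potential is large (`spread_or_spread_neg`).

Lower bound. If each bin is chosen with probability at least q/n in every round, the probability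
that no bin reaches load M is at most the value for independent bins (`stepOp_missPot_le`), and a
binomial estimate makes it small for M of order log n after order n log n rounds. In Mean-Thinning
an overloaded bin has probability only δ/n, so rounds with tiny δ do not count. The potential
`fewOverPot`, bounded below by -1600n, decreases on average in those rounds, hence a constant
fraction of the rounds count with high probability (`stepOp_iterate_thinning_le`). -/

open scoped NNReal

noncomputable section

namespace BallsBins

/-! ### Expectations and allocation kernels -/

/-- The expectation of a nonnegative function under a discrete law. -/
def expect {α : Type*} (μ : PMF α) (g : α → ENNReal) : ENNReal := ∑' a, μ a * g a

theorem expect_pure {α : Type*} (a : α) (g : α → ENNReal) : expect (PMF.pure a) g = g a := by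
  classical
  unfold expect
  rw [tsum_eq_single a]
  · simp
  · intro b hb
    simp [PMF.pure_apply, hb]

theorem expect_bind {α β : Type*} (μ : PMF α) (κ : α → PMF β) (g : β → ENNReal) :
    expect (μ.bind κ) g = expect μ (fun a => expect (κ a) g) := by
  unfold expect
  simp only [PMF.bind_apply, ← ENNReal.tsum_mul_right, ← ENNReal.tsum_mul_left]
  rw [ENNReal.tsum_comm]
  simp only [mul_assoc]

theorem expect_sample (n : ℕ) [NeZero n] (g : Fin n → ENNReal) :
    expect (sample n) g = ∑ i, (n : ENNReal)⁻¹ * g i := by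
  simp [expect, sample, tsum_fintype]

theorem expect_congr {α : Type*} (μ : PMF α) {g g' : α → ENNReal}
    (h : ∀ a ∈ μ.support, g a = g' a) : expect μ g = expect μ g' := by
  unfold expect
  refine tsum_congr fun a => ?_
  by_cases ha : a ∈ μ.support
  · rw [h a ha]
  · rw [PMF.mem_support_iff, not_not] at ha
    simp [ha]

/-- The averaging operator of the kernel that puts `w x i` balls into bin `i` with
probability `p x i`. -/
def stepOp {n : ℕ} (p : Load n → Fin n → ℝ) (w : Load n → Fin n → ℕ) (g : Load n → ℝ)
    (x : Load n) : ℝ :=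
  ∑ i, p x i * g (addBalls x i (w x i))

/-- Weights of an allocation kernel with at least one and at most two balls per round in which no
bin is much more likely than under uniform allocation. -/
structure Admissible {n : ℕ} (p : Load n → Fin n → ℝ) (w : Load n → Fin n → ℕ) : Prop where
  nonneg : ∀ x i, 0 ≤ p x i
  sum_eq_one : ∀ x, ∑ i, p x i = 1
  one_le : ∀ x i, 1 ≤ w x i
  le_two : ∀ x i, w x i ≤ 2
  mul_sq_le : ∀ x i, p x i * (w x i : ℝ) ^ 2 ≤ 4 / n

/-- The process `Q` on `n` bins moves according to the kernel with weights `p`, `w`. -/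
def Represents (Q : AllocProcess) (n : ℕ) [NeZero n] (p : Load n → Fin n → ℝ)
    (w : Load n → Fin n → ℕ) : Prop :=
  ∀ (t : ℕ) (g : Load n → ENNReal), expect (loadLaw Q n (t + 1)) g =
    expect (loadLaw Q n t) fun x => ∑ i, ENNReal.ofReal (p x i) * g (addBalls x i (w x i))

/-! ### Iterates of the averaging operator -/

section StepOp

variable {n : ℕ} {p : Load n → Fin n → ℝ} {w : Load n → Fin n → ℕ}

theorem stepOp_mono (hp : ∀ x i, 0 ≤ p x i) {g g' : Load n → ℝ} (h : ∀ x, g x ≤ g' x)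
    (x : Load n) : stepOp p w g x ≤ stepOp p w g' x :=
  Finset.sum_le_sum fun i _ => mul_le_mul_of_nonneg_left (h _) (hp x i)

theorem stepOp_affine (hp : ∀ x, ∑ i, p x i = 1) (a b : ℝ) (g : Load n → ℝ) :
    stepOp p w (fun x => a * g x + b) = fun x => a * stepOp p w g x + b := by
  funext x
  unfold stepOp
  calc ∑ i, p x i * (a * g (addBalls x i (w x i)) + b)
      = a * ∑ i, p x i * g (addBalls x i (w x i)) + b * ∑ i, p x i := by
        rw [Finset.mul_sum, Finset.mul_sum, ← Finset.sum_add_distrib]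
        exact Finset.sum_congr rfl fun i _ => by ring
    _ = _ := by rw [hp, mul_one]

theorem stepOp_iterate_mono (hp : ∀ x i, 0 ≤ p x i) (m : ℕ) {g g' : Load n → ℝ}
    (h : ∀ x, g x ≤ g' x) (x : Load n) : (stepOp p w)^[m] g x ≤ (stepOp p w)^[m] g' x := by
  induction m generalizing g g' with
  | zero => exact h x
  | succ m ih => exact ih (stepOp_mono hp h)

theorem stepOp_iterate_affine (hp : ∀ x, ∑ i, p x i = 1) (m : ℕ) (a b : ℝ) (g : Load n → ℝ)
    (x : Load n) :
    (stepOp p w)^[m] (fun x => a * g x + b) x = a * (stepOp p w)^[m] g x + b := by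
  induction m generalizing g with
  | zero => rfl
  | succ m ih =>
    rw [Function.iterate_succ_apply, stepOp_affine hp, ih, Function.iterate_succ_apply]

/-- A geometric drift condition bounds the expectation at all times. -/
theorem stepOp_iterate_le_of_drift (h0 : ∀ x i, 0 ≤ p x i) (h1 : ∀ x, ∑ i, p x i = 1)
    {V : Load n → ℝ} {r A : ℝ} (hr : 0 < r) (hr1 : r ≤ 1) (hA : 0 ≤ A)
    (hV : ∀ x, stepOp p w V x ≤ (1 - r) * V x + A) (m : ℕ) (x : Load n) (hx : 0 ≤ V x) :
    (stepOp p w)^[m] V x ≤ V x + A / r := by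
  induction m with
  | zero => simpa using div_nonneg hA hr.le
  | succ m ih =>
    rw [Function.iterate_succ_apply]
    calc (stepOp p w)^[m] (stepOp p w V) x
        ≤ (stepOp p w)^[m] (fun x => (1 - r) * V x + A) x := stepOp_iterate_mono h0 m hV x
      _ = (1 - r) * (stepOp p w)^[m] V x + A := stepOp_iterate_affine h1 m _ _ _ _
      _ ≤ (1 - r) * (V x + A / r) + A := by gcongr
      _ = (1 - r) * V x + A / r := by field_simp; ring
      _ ≤ V x + A / r := by nlinarith

/-- The backward equation: one round of the law is moved onto the test function at a time. It turns
probabilities into real-valued iterates started from the empty load vector. -/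
theorem expect_loadLaw {Q : AllocProcess} [NeZero n] (hQ : Represents Q n p w)
    (h0 : ∀ x i, 0 ≤ p x i) (m : ℕ) (g : Load n → ℝ) (hg : ∀ x, 0 ≤ g x) :
    expect (loadLaw Q n m) (fun x => ENNReal.ofReal (g x)) =
      ENNReal.ofReal ((stepOp p w)^[m] g 0) := by
  induction m generalizing g with
  | zero => simp [loadLaw, expect_pure]
  | succ m ih =>
    rw [hQ, Function.iterate_succ_apply, ← ih]
    · congr 1
      funext x
      unfold stepOp
      rw [ENNReal.ofReal_sum_of_nonneg fun i _ => mul_nonneg (h0 x i) (hg _)]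
      exact Finset.sum_congr rfl fun i _ => (ENNReal.ofReal_mul (h0 x i)).symm
    · exact fun x => Finset.sum_nonneg fun i _ => mul_nonneg (h0 x i) (hg _)

open Classical in
theorem gapProb_eq {Q : AllocProcess} [NeZero n] (hQ : Represents Q n p w)
    (h0 : ∀ x i, 0 ≤ p x i) (m : ℕ) (S : ℝ → Prop) :
    gapProb Q n m S = (stepOp p w)^[m] (fun x => if S (gap x) then 1 else 0) 0 := by
  have key := expect_loadLaw hQ h0 m (fun x => if S (gap x) then (1 : ℝ) else 0)
    (fun x => by split_ifs <;> norm_num)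
  have hnn : 0 ≤ (stepOp p w)^[m] (fun x => if S (gap x) then (1 : ℝ) else 0) 0 := by
    have hz : (stepOp p w)^[m] (fun _ => (0 : ℝ)) 0 = 0 := by
      have : stepOp p w (fun _ => (0 : ℝ)) = fun _ => 0 := by funext x; simp [stepOp]
      exact congrFun (Function.iterate_fixed this m) 0
    refine hz.symm.le.trans (stepOp_iterate_mono h0 m (g := fun _ => (0 : ℝ)) (fun x => ?_) 0)
    split_ifs <;> norm_num
  unfold gapProb
  rw [MeasureTheory.measureReal_def, PMF.toMeasure_apply _ (MeasurableSet.of_discrete)]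
  rw [← ENNReal.toReal_ofReal hnn, ← key]
  congr 1
  unfold expect
  refine tsum_congr fun x => ?_
  by_cases hx : S (gap x) <;> simp [Set.indicator, hx]

end StepOp

/-! ### The weights of the three processes -/

/-- Deviation of the load of bin `i` from the mean load. -/
def dev {n : ℕ} (x : Load n) (i : Fin n) : ℝ := (x i : ℝ) - (totalLoad x : ℝ) / n

/-- The fraction of bins whose load is at least the mean load. -/
def overFrac {n : ℕ} (x : Load n) : ℝ :=
  ((Finset.univ.filter fun i => 0 ≤ dev x i).card : ℝ) / n

theorem totalLoad_addBalls {n : ℕ} (x : Load n) (i : Fin n) (k : ℕ) :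
    totalLoad (addBalls x i k) = totalLoad x + k := by
  unfold totalLoad addBalls
  rw [Finset.sum_update_of_mem (Finset.mem_univ i), ← Finset.add_sum_erase _ _ (Finset.mem_univ i),
    Finset.sdiff_singleton_eq_erase]
  omega

open Classical in
/-- Allocation probabilities of Mean-Thinning. -/
def thinningProb {n : ℕ} (x : Load n) (i : Fin n) : ℝ :=
  ((if dev x i < 0 then 1 else 0) + overFrac x) / n

open Classical in
/-- Numbers of balls allocated by Twinning. -/
def twinningBalls {n : ℕ} (x : Load n) (i : Fin n) : ℕ := if dev x i < 0 then 2 else 1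

/-- Allocation probabilities of Two-Choice. -/
def twoChoiceProb {n : ℕ} (x : Load n) (i : Fin n) : ℝ :=
  ((Finset.univ.filter fun q : Fin n × Fin n => lighter x q.1 q.2 = i).card : ℝ) / n ^ 2

/-- Allocation probabilities of the `(1+β)`-process. -/
def mixedProb (β : ℝ≥0) {n : ℕ} (x : Load n) (i : Fin n) : ℝ :=
  (1 - β) / n + β * twoChoiceProb x i

theorem ofReal_inv_natCast (n : ℕ) [NeZero n] : ENNReal.ofReal ((n : ℝ)⁻¹) = (n : ENNReal)⁻¹ := by
  rw [ENNReal.ofReal_inv_of_pos (by exact_mod_cast Nat.pos_of_ne_zero (NeZero.ne n)),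
    ENNReal.ofReal_natCast]

theorem represents_twinning (n : ℕ) [NeZero n] :
    Represents twinning n (fun _ _ => (n : ℝ)⁻¹) twinningBalls := by
  intro t g
  rw [loadLaw, expect_bind]
  congr 1
  funext x
  simp only [twinning, expect_bind, expect_sample, expect_pure, ofReal_inv_natCast]
  refine Finset.sum_congr rfl fun i _ => ?_
  by_cases h : dev x i < 0
  · rw [if_pos (by rwa [dev, sub_neg] at h), twinningBalls, if_pos h]
  · rw [if_neg (by rwa [dev, sub_neg] at h), twinningBalls, if_neg h]

theorem mem_support_meanThinning (n : ℕ) [NeZero n] (t : ℕ) :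
    ∀ x ∈ (loadLaw meanThinning n t).support, totalLoad x = t := by
  induction t with
  | zero => intro x hx; simp [loadLaw] at hx; simp [hx, totalLoad]
  | succ t ih =>
    intro x hx
    simp only [loadLaw, meanThinning, PMF.mem_support_bind_iff, PMF.mem_support_pure_iff] at hx
    obtain ⟨y, hy, i, -, j, -, rfl⟩ := hx
    split_ifs <;> rw [totalLoad_addBalls, ih y hy]

/-- The rule compares with `t / n`, which is the true mean only on the support of the law, since
each round adds exactly one ball. A bin gets the ball as an underloaded first sample, or as second
sample after an overloaded first one; the latter has probability `overFrac x / n`. -/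
theorem represents_meanThinning (n : ℕ) [NeZero n] :
    Represents meanThinning n thinningProb (fun _ _ => 1) := by
  intro t g
  rw [loadLaw, expect_bind]
  refine expect_congr _ fun x hx => ?_
  have ht := mem_support_meanThinning n t x hx
  have hn : (0 : ℝ) < n := by exact_mod_cast Nat.pos_of_ne_zero (NeZero.ne n)
  simp only [meanThinning, expect_bind, expect_sample, expect_pure]
  have h1 : ∀ i, ENNReal.ofReal (thinningProb x i) =
      (if dev x i < 0 then (n : ENNReal)⁻¹ else 0) +
        ∑ j, (n : ENNReal)⁻¹ * if dev x j < 0 then 0 else (n : ENNReal)⁻¹ := by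
    intro i
    have h2 : ENNReal.ofReal (overFrac x / n) =
        ∑ j, (n : ENNReal)⁻¹ * if dev x j < 0 then 0 else (n : ENNReal)⁻¹ := by
      rw [← Finset.mul_sum, div_eq_inv_mul, ENNReal.ofReal_mul (by positivity), ofReal_inv_natCast,
        overFrac, Finset.card_filter, Nat.cast_sum, div_eq_inv_mul,
        ENNReal.ofReal_mul (by positivity), ofReal_inv_natCast, ← Nat.cast_sum,
        ENNReal.ofReal_natCast, Nat.cast_sum, Finset.mul_sum]
      congr 1
      refine Finset.sum_congr rfl fun j _ => ?_
      by_cases h : dev x j < 0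
      · simp [h, not_le.2 h]
      · simp [h, not_lt.1 h]
    rw [thinningProb, add_div, ENNReal.ofReal_add, h2]
    · congr 1
      split_ifs
      · rw [one_div, ofReal_inv_natCast]
      · simp
    · split_ifs <;> positivity
    · unfold overFrac; positivity
  have h3 : ∀ i : Fin n, ((x i : ℝ) < (t : ℝ) / n) ↔ dev x i < 0 := by
    intro i; rw [dev, ht, sub_neg]
  simp only [h1, h3, add_mul, Finset.sum_add_distrib]
  have h4 : ∀ i : Fin n, (n : ENNReal)⁻¹ * ∑ j, (n : ENNReal)⁻¹ *
      g (if dev x i < 0 then addBalls x i 1 else addBalls x j 1) =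
      (if dev x i < 0 then (n : ENNReal)⁻¹ else 0) * g (addBalls x i 1) +
      ((n : ENNReal)⁻¹ * if dev x i < 0 then 0 else (n : ENNReal)⁻¹) *
        ∑ j, g (addBalls x j 1) := by
    intro i
    split_ifs
    · have hc : ∑ _j : Fin n, (n : ENNReal)⁻¹ * g (addBalls x i 1) = g (addBalls x i 1) := by
        rw [Finset.sum_const, Finset.card_univ, Fintype.card_fin, nsmul_eq_mul, ← mul_assoc,
          ENNReal.mul_inv_cancel (by simpa using NeZero.ne n) (by simp), one_mul]
      rw [hc]; simp
    · rw [← Finset.mul_sum]; simp [mul_assoc]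
  rw [Finset.sum_congr rfl fun i _ => h4 i, Finset.sum_add_distrib, ← Finset.sum_mul,
    Finset.mul_sum]

theorem sum_twoChoiceProb_mul {n : ℕ} (x : Load n) (g : Fin n → ℝ) :
    ∑ i, twoChoiceProb x i * g i = (∑ i, ∑ j, g (lighter x i j)) / n ^ 2 := by
  rw [← Finset.sum_product', Finset.univ_product_univ,
    ← Finset.sum_fiberwise_of_maps_to (s := Finset.univ) (t := Finset.univ)
      (g := fun q : Fin n × Fin n => lighter x q.1 q.2) (fun _ _ => Finset.mem_univ _),
    Finset.sum_div]
  refine Finset.sum_congr rfl fun i _ => ?_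
  rw [twoChoiceProb, Finset.sum_congr rfl (g := fun _ => g i)
    (fun q hq => by rw [(Finset.mem_filter.1 hq).2]), Finset.sum_const, nsmul_eq_mul]
  ring

theorem represents_onePlusBeta (β : ℝ≥0) (hβ : β ≤ 1) (n : ℕ) [NeZero n] :
    Represents (onePlusBeta β hβ) n (mixedProb β) (fun _ _ => 1) := by
  intro t g
  rw [loadLaw, expect_bind]
  congr 1
  funext x
  have hβ' : (0 : ℝ) ≤ 1 - β := by have : (β : ℝ) ≤ 1 := by exact_mod_cast hβ
                                   linarith
  have hcoin : ∀ G : Bool → ENNReal, expect (coin β hβ) G =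
      (β : ENNReal) * G true + ((1 - β : ℝ≥0) : ENNReal) * G false := by
    intro G
    simp [expect, coin, tsum_fintype]
  have h2 : ∑ i, ENNReal.ofReal (twoChoiceProb x i) * g (addBalls x i 1) =
      ∑ i, (n : ENNReal)⁻¹ * ∑ j, (n : ENNReal)⁻¹ * g (addBalls x (lighter x i j) 1) := by
    simp only [Finset.mul_sum, ← mul_assoc]
    rw [← Finset.sum_product', Finset.univ_product_univ,
      ← Finset.sum_fiberwise_of_maps_to (s := Finset.univ) (t := Finset.univ)
        (g := fun q : Fin n × Fin n => lighter x q.1 q.2) (fun _ _ => Finset.mem_univ _)]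
    refine Finset.sum_congr rfl fun i _ => ?_
    rw [twoChoiceProb, Finset.sum_congr rfl
      (g := fun _ => (n : ENNReal)⁻¹ * (n : ENNReal)⁻¹ * g (addBalls x i 1))
      (fun q hq => by rw [(Finset.mem_filter.1 hq).2]), Finset.sum_const, nsmul_eq_mul,
      div_eq_mul_inv, ENNReal.ofReal_mul (by positivity), ENNReal.ofReal_natCast, pow_two, mul_inv,
      ENNReal.ofReal_mul (by positivity), ofReal_inv_natCast]
    simp only [mul_assoc]
  simp only [onePlusBeta, expect_bind, hcoin, if_true, Bool.false_eq_true, if_false, twoChoice,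
    oneChoice, expect_sample, expect_pure]
  rw [← h2, Finset.mul_sum, Finset.mul_sum, ← Finset.sum_add_distrib]
  refine Finset.sum_congr rfl fun i _ => ?_
  have ht : 0 ≤ twoChoiceProb x i := by unfold twoChoiceProb; positivity
  rw [mixedProb, div_eq_mul_inv, ENNReal.ofReal_add (by positivity) (by positivity),
    ENNReal.ofReal_mul hβ', ENNReal.ofReal_mul (p := (β : ℝ)) β.2, ofReal_inv_natCast, ENNReal.ofReal_coe_nnreal,
    show ENNReal.ofReal (1 - (β : ℝ)) = ((1 - β : ℝ≥0) : ENNReal) by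
      rw [← NNReal.coe_one, ← NNReal.coe_sub hβ, ENNReal.ofReal_coe_nnreal]]
  ring

/-! ### Exponential potentials -/

section Potentials

variable {n : ℕ}

theorem dev_addBalls (x : Load n) (i : Fin n) (k : ℕ) (j : Fin n) :
    dev (addBalls x i k) j = dev x j + k * ((if j = i then 1 else 0) - 1 / n) := by
  unfold dev
  rw [totalLoad_addBalls]
  by_cases h : j = i
  · subst h
    simp [addBalls]
    ring
  · simp [addBalls, h]
    ring

theorem sum_dev [NeZero n] (x : Load n) : ∑ i, dev x i = 0 := by
  have hn : (n : ℝ) ≠ 0 := by exact_mod_cast NeZero.ne n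
  simp only [dev, Finset.sum_sub_distrib, Finset.sum_const, Finset.card_univ, Fintype.card_fin,
    nsmul_eq_mul, totalLoad, Nat.cast_sum]
  field_simp
  ring

/-- The exponential potential with parameter `a`. -/
def expPot (a : ℝ) (x : Load n) : ℝ := ∑ j, Real.exp (a * dev x j)

/-- Expected change of the deviation of bin `i` in one round. -/
def drift (p : Load n → Fin n → ℝ) (w : Load n → Fin n → ℕ) (x : Load n) (i : Fin n) : ℝ :=
  p x i * w x i - (∑ j, p x j * w x j) / n

theorem expPot_pos [NeZero n] (a : ℝ) (x : Load n) : 0 < expPot a x :=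
  Finset.sum_pos (fun _ _ => Real.exp_pos _) Finset.univ_nonempty

theorem exp_le_expPot (a : ℝ) (x : Load n) (j : Fin n) : Real.exp (a * dev x j) ≤ expPot a x :=
  Finset.single_le_sum (f := fun j => Real.exp (a * dev x j))
    (fun _ _ => (Real.exp_pos _).le) (Finset.mem_univ j)

theorem card_le_expPot [NeZero n] (a : ℝ) (x : Load n) : (n : ℝ) ≤ expPot a x := by
  have h : ∑ j, (a * dev x j + 1) ≤ expPot a x :=
    Finset.sum_le_sum fun j _ => Real.add_one_le_exp _
  rw [Finset.sum_add_distrib, ← Finset.mul_sum, sum_dev] at h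
  simpa using h

theorem exp_le_quadratic {u : ℝ} (hu : |u| ≤ 1) : Real.exp u ≤ 1 + u + u ^ 2 := by
  have := (abs_le.1 (Real.abs_exp_sub_one_sub_id_le hu)).2
  linarith

theorem expPot_addBalls_le [NeZero n] {a : ℝ} (ha : |a| ≤ 1 / 4) (x : Load n) (i : Fin n) {k : ℕ}
    (hk : k ≤ 2) :
    expPot a (addBalls x i k) ≤ expPot a x + Real.exp (a * dev x i) * (a * k + a ^ 2 * k ^ 2) +
      expPot a x * (-(a * k) / n + a ^ 2 * k ^ 2 / n) := by
  have hn : (1 : ℝ) ≤ n := by exact_mod_cast Nat.pos_of_ne_zero (NeZero.ne n)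
  have hk' : (k : ℝ) ≤ 2 := by exact_mod_cast hk
  have hinv : (n : ℝ)⁻¹ ≤ 1 := inv_le_one_of_one_le₀ hn
  have hinv0 : 0 < (n : ℝ)⁻¹ := by positivity
  set u : ℝ := a * k with hu
  have hu1 : |u| ≤ 1 / 2 := by
    rw [hu, abs_mul, Nat.abs_cast]
    nlinarith [abs_nonneg a]
  have key : ∀ j, Real.exp (a * dev (addBalls x i k) j) ≤ Real.exp (a * dev x j) *
      (1 + -u / n + u ^ 2 / n) +
      if j = i then Real.exp (a * dev x i) * (u + u ^ 2) else 0 := by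
    intro j
    rw [dev_addBalls, mul_add, Real.exp_add]
    have hpos := Real.exp_pos (a * dev x j)
    have hsq : (n : ℝ)⁻¹ ^ 2 ≤ (n : ℝ)⁻¹ := by nlinarith
    by_cases h : j = i
    · subst h
      have h1 : a * (k * ((if j = j then 1 else 0) - 1 / (n : ℝ))) = u * (1 - (n : ℝ)⁻¹) := by
        rw [if_pos rfl, hu]; ring
      have h2 : |u * (1 - (n : ℝ)⁻¹)| ≤ 1 := by
        rw [abs_mul, abs_of_nonneg (by linarith : 0 ≤ 1 - (n : ℝ)⁻¹)]
        nlinarith [abs_nonneg u]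
      have h3 := exp_le_quadratic h2
      rw [h1, if_pos rfl, ← mul_add]
      refine mul_le_mul_of_nonneg_left (h3.trans ?_) hpos.le
      rw [div_eq_mul_inv, div_eq_mul_inv]
      nlinarith [sq_nonneg u, mul_nonneg (sq_nonneg u) hinv0.le,
        mul_nonneg (sq_nonneg u) (sub_nonneg.2 hsq)]
    · have h1 : a * (k * ((if j = i then 1 else 0) - 1 / (n : ℝ))) = -(u * (n : ℝ)⁻¹) := by
        rw [if_neg h, hu]; ring
      have h2 : |-(u * (n : ℝ)⁻¹)| ≤ 1 := by
        rw [abs_neg, abs_mul, abs_of_nonneg hinv0.le]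
        nlinarith [abs_nonneg u]
      have h3 := exp_le_quadratic h2
      rw [h1, if_neg h, add_zero]
      refine mul_le_mul_of_nonneg_left (h3.trans ?_) hpos.le
      rw [div_eq_mul_inv, div_eq_mul_inv]
      nlinarith [mul_nonneg (sq_nonneg u) (sub_nonneg.2 hsq)]
  calc expPot a (addBalls x i k) ≤ ∑ j, (Real.exp (a * dev x j) * (1 + -u / n + u ^ 2 / n) +
      if j = i then Real.exp (a * dev x i) * (u + u ^ 2) else 0) :=
        Finset.sum_le_sum fun j _ => key j
    _ = _ := by
      rw [Finset.sum_add_distrib, ← Finset.sum_mul, Finset.sum_ite_eq' Finset.univ i]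
      simp only [Finset.mem_univ, if_true, expPot, hu]
      ring

/-- The second-order error is 8a²/n: by `mul_sq_le` the chosen bin contributes 4a²/n, and the shift
of the mean contributes another 4a²/n. -/
theorem stepOp_expPot_le [NeZero n] {p : Load n → Fin n → ℝ} {w : Load n → Fin n → ℕ}
    (h : Admissible p w) {a : ℝ} (ha : |a| ≤ 1 / 4) (x : Load n) :
    stepOp p w (expPot a) x ≤ (1 + 8 * a ^ 2 / n) * expPot a x +
      a * ∑ i, drift p w x i * Real.exp (a * dev x i) := by
  have hn : (0 : ℝ) < n := by exact_mod_cast Nat.pos_of_ne_zero (NeZero.ne n)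
  have hΦ := expPot_pos a x
  have h1 : stepOp p w (expPot a) x ≤ ∑ i, p x i * (expPot a x +
      Real.exp (a * dev x i) * (a * w x i + a ^ 2 * w x i ^ 2) +
      expPot a x * (-(a * w x i) / n + a ^ 2 * w x i ^ 2 / n)) :=
    Finset.sum_le_sum fun i _ => mul_le_mul_of_nonneg_left
      (expPot_addBalls_le ha x i (h.le_two x i)) (h.nonneg x i)
  have h2 : ∑ i, p x i * (expPot a x +
      Real.exp (a * dev x i) * (a * w x i + a ^ 2 * w x i ^ 2) +
      expPot a x * (-(a * w x i) / n + a ^ 2 * w x i ^ 2 / n)) =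
      expPot a x * (∑ i, p x i) + a * ∑ i, drift p w x i * Real.exp (a * dev x i) +
      a ^ 2 * ∑ i, (p x i * w x i ^ 2) * Real.exp (a * dev x i) +
      a ^ 2 * expPot a x / n * ∑ i, p x i * w x i ^ 2 := by
    have h3 : ∑ i, drift p w x i * Real.exp (a * dev x i) =
        ∑ i, p x i * w x i * Real.exp (a * dev x i) - expPot a x / n * ∑ i, p x i * w x i := by
      simp only [drift, sub_mul, Finset.sum_sub_distrib, ← Finset.mul_sum, expPot]
      ring
    rw [h3, mul_sub, Finset.mul_sum, Finset.mul_sum, Finset.mul_sum, Finset.mul_sum,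
      Finset.mul_sum, Finset.mul_sum, ← Finset.sum_sub_distrib, ← Finset.sum_add_distrib,
      ← Finset.sum_add_distrib, ← Finset.sum_add_distrib]
    exact Finset.sum_congr rfl fun i _ => by ring
  have h4 : ∑ i, (p x i * w x i ^ 2) * Real.exp (a * dev x i) ≤ 4 / n * expPot a x := by
    rw [expPot, Finset.mul_sum]
    exact Finset.sum_le_sum fun i _ =>
      mul_le_mul_of_nonneg_right (h.mul_sq_le x i) (Real.exp_pos _).le
  have h5 : ∑ i, p x i * (w x i : ℝ) ^ 2 ≤ 4 := by
    calc _ ≤ ∑ _i : Fin n, 4 / (n : ℝ) := Finset.sum_le_sum fun i _ => h.mul_sq_le x i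
      _ = 4 := by simp; field_simp
  rw [h2, h.sum_eq_one] at h1
  have h6 := mul_le_mul_of_nonneg_left h4 (sq_nonneg a)
  have h7 := mul_le_mul_of_nonneg_left h5
    (by positivity : 0 ≤ a ^ 2 * expPot a x / n)
  calc _ ≤ _ := h1
    _ ≤ expPot a x * 1 + a * ∑ i, drift p w x i * Real.exp (a * dev x i) +
      a ^ 2 * (4 / n * expPot a x) + a ^ 2 * expPot a x / n * 4 := by linarith
    _ = _ := by ring

/-! ### The Huber potential -/

/-- The Huber function: `y ^ 2` on `[-K, K]`, continued linearly. -/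
def huber (K y : ℝ) : ℝ := 2 * max (-K) (min y K) * y - max (-K) (min y K) ^ 2

theorem abs_clamp_le {K : ℝ} (hK : 0 ≤ K) (y : ℝ) : |max (-K) (min y K)| ≤ K :=
  abs_le.2 ⟨le_max_left _ _, max_le (by linarith) (min_le_right _ _)⟩

/-- The Huber function is the upper envelope of the tangents of y² with base point in [-K, K].
Convexity and the Lipschitz constant 2K follow from this. -/
theorem tangent_le_huber {K : ℝ} {t : ℝ} (ht : |t| ≤ K) (y : ℝ) :
    2 * t * y - t ^ 2 ≤ huber K y := by
  obtain ⟨h1, h2⟩ := abs_le.1 ht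
  unfold huber
  rcases le_total y K with h | h
  · rw [min_eq_left h]
    rcases le_total (-K) y with h' | h'
    · rw [max_eq_right h']; nlinarith [sq_nonneg (y - t)]
    · rw [max_eq_left h']; nlinarith
  · rw [min_eq_right h, max_eq_right (by linarith)]; nlinarith

theorem huber_nonneg {K : ℝ} (hK : 0 ≤ K) (y : ℝ) : 0 ≤ huber K y := by
  simpa using tangent_le_huber (t := 0) (by simpa using hK) y

theorem huber_eq_sq {K y : ℝ} (hy : |y| ≤ K) : huber K y = y ^ 2 := by
  obtain ⟨h1, h2⟩ := abs_le.1 hy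
  rw [huber, min_eq_left h2, max_eq_right h1]; ring

theorem huber_le {K : ℝ} (hK : 0 ≤ K) (y : ℝ) : huber K y ≤ 2 * K * |y| := by
  have h1 := abs_clamp_le hK y
  unfold huber
  have h2 : max (-K) (min y K) * y ≤ K * |y| := by
    refine (le_abs_self _).trans ?_
    rw [abs_mul]
    exact mul_le_mul_of_nonneg_right h1 (abs_nonneg _)
  nlinarith [sq_nonneg (max (-K) (min y K))]

theorem abs_huber_sub_le {K : ℝ} (hK : 0 ≤ K) (y z : ℝ) :
    |huber K z - huber K y| ≤ 2 * K * |z - y| := by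
  have key : ∀ y z, huber K z - huber K y ≤ 2 * K * |z - y| := by
    intro y z
    have h1 := abs_clamp_le hK z
    have h2 := tangent_le_huber h1 y
    have h3 : max (-K) (min z K) * (z - y) ≤ K * |z - y| := by
      refine (le_abs_self _).trans ?_
      rw [abs_mul]
      exact mul_le_mul_of_nonneg_right h1 (abs_nonneg _)
    rw [huber]
    linarith
  rw [abs_le]
  have := key z y
  rw [abs_sub_comm] at this
  exact ⟨by linarith, key y z⟩

/-- The Huber potential. -/
def huberPot (K : ℝ) (x : Load n) : ℝ := ∑ j, huber K (dev x j)

theorem huberPot_nonneg {K : ℝ} (hK : 0 ≤ K) (x : Load n) : 0 ≤ huberPot K x :=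
  Finset.sum_nonneg fun _ _ => huber_nonneg hK _

theorem sum_abs_indicator_sub_le [NeZero n] (i : Fin n) :
    ∑ j, |(if j = i then (1 : ℝ) else 0) - 1 / n| ≤ 2 := by
  have hn : (0 : ℝ) < n := by exact_mod_cast Nat.pos_of_ne_zero (NeZero.ne n)
  calc ∑ j, |(if j = i then (1 : ℝ) else 0) - 1 / n|
      ≤ ∑ j, ((if j = i then (1 : ℝ) else 0) + 1 / n) := by
        refine Finset.sum_le_sum fun j _ => (abs_sub _ _).trans ?_
        rw [abs_of_nonneg (by split_ifs <;> norm_num), abs_of_nonneg (by positivity)]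
    _ = 2 := by
        rw [Finset.sum_add_distrib]
        simp
        field_simp
        norm_num

theorem abs_huberPot_addBalls_sub_le [NeZero n] {K : ℝ} (hK : 0 ≤ K) (x : Load n) (i : Fin n)
    (k : ℕ) : |huberPot K (addBalls x i k) - huberPot K x| ≤ 4 * K * k := by
  unfold huberPot
  rw [← Finset.sum_sub_distrib]
  calc _ ≤ ∑ j, |huber K (dev (addBalls x i k) j) - huber K (dev x j)| :=
        Finset.abs_sum_le_sum_abs _ _
    _ ≤ ∑ j, 2 * K * k * |(if j = i then (1 : ℝ) else 0) - 1 / n| := by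
        refine Finset.sum_le_sum fun j _ => (abs_huber_sub_le hK _ _).trans (le_of_eq ?_)
        rw [dev_addBalls, add_sub_cancel_left, abs_mul, Nat.abs_cast]
        ring
    _ ≤ 2 * K * k * 2 := by
        rw [← Finset.mul_sum]
        exact mul_le_mul_of_nonneg_left (sum_abs_indicator_sub_le i) (by positivity)
    _ = _ := by ring

/-- Convexity gives the first-order term for every bin. A bin of `G` stays in the quadratic range
even after two balls, hence the margin `K - 2`, and gains its squared jump in addition; that jump is
at least half of `w` because `n ≥ 2`. Unlike a quadratic potential, the first-order loss does not
grow with far-away bins. -/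
theorem le_stepOp_huberPot [NeZero n] {p : Load n → Fin n → ℝ} {w : Load n → Fin n → ℕ}
    (h : Admissible p w) (hn2 : 2 ≤ n) {K : ℝ} (hK : 0 ≤ K) (x : Load n) (G : Finset (Fin n))
    (hG : ∀ j ∈ G, |dev x j| ≤ K - 2) :
    huberPot K x + 2 * ∑ j, max (-K) (min (dev x j) K) * drift p w x j +
      (∑ j ∈ G, p x j * w x j ^ 2) / 4 ≤ stepOp p w (huberPot K) x := by
  classical
  have hn : (2 : ℝ) ≤ n := by exact_mod_cast hn2
  have hinv0 : 0 < 1 / (n : ℝ) := by positivity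
  have hinv : 1 / (n : ℝ) ≤ 1 / 2 := one_div_le_one_div_of_le (by norm_num) hn
  set s : Fin n → ℝ := fun j => max (-K) (min (dev x j) K) with hs
  have key : ∀ i j, huber K (dev x j) +
      2 * s j * (w x i * ((if j = i then 1 else 0) - 1 / n)) +
      (if j = i then (if j ∈ G then (w x i : ℝ) ^ 2 / 4 else 0) else 0) ≤
      huber K (dev (addBalls x i (w x i)) j) := by
    intro i j
    rw [dev_addBalls]
    have hbase : huber K (dev x j) + 2 * s j * (w x i * ((if j = i then 1 else 0) - 1 / n)) ≤
        huber K (dev x j + w x i * ((if j = i then 1 else 0) - 1 / n)) := by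
      refine le_trans (le_of_eq ?_) (tangent_le_huber (abs_clamp_le hK (dev x j)) _)
      simp only [huber, hs]
      ring
    by_cases hji : j = i
    · by_cases hjG : j ∈ G
      · subst hji
        have hw0 : (0 : ℝ) ≤ w x j := Nat.cast_nonneg _
        have hw : (w x j : ℝ) ≤ 2 := by exact_mod_cast h.le_two x j
        obtain ⟨h1, h2⟩ := abs_le.1 (hG j hjG)
        have hsj : s j = dev x j := by
          simp only [hs]
          rw [min_eq_left (by linarith), max_eq_right (by linarith)]
        simp only [if_true, if_pos hjG]
        rw [huber_eq_sq (abs_le.2 ⟨by linarith, by linarith⟩),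
          huber_eq_sq (abs_le.2 ⟨by nlinarith, by nlinarith⟩), hsj]
        have : (1 / 2 : ℝ) ^ 2 ≤ (1 - 1 / (n : ℝ)) ^ 2 :=
          pow_le_pow_left₀ (by norm_num) (by linarith) 2
        nlinarith [mul_le_mul_of_nonneg_left this (sq_nonneg (w x j : ℝ))]
      · simpa [hjG] using hbase
    · have : (if j = i then (if j ∈ G then (w x i : ℝ) ^ 2 / 4 else 0) else 0) = 0 := if_neg hji
      rw [this, add_zero]
      exact hbase
  have h2 : ∀ i, huberPot K x + 2 * (w x i * s i - w x i / n * ∑ j, s j) +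
      (if i ∈ G then (w x i : ℝ) ^ 2 / 4 else 0) ≤ huberPot K (addBalls x i (w x i)) := by
    intro i
    refine le_trans (le_of_eq ?_) (Finset.sum_le_sum fun j _ => key i j)
    rw [Finset.sum_add_distrib, Finset.sum_add_distrib, Finset.sum_ite_eq' Finset.univ i]
    simp only [Finset.mem_univ, if_true, huberPot, mul_sub, Finset.sum_sub_distrib, mul_ite,
      mul_one, mul_zero, Finset.sum_ite_eq' Finset.univ i, Finset.mul_sum]
    congr 2
    congr 1
    · ring
    · exact Finset.sum_congr rfl fun j _ => by ring
  have h3 := Finset.sum_le_sum fun i (_ : i ∈ Finset.univ) =>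
    mul_le_mul_of_nonneg_left (h2 i) (h.nonneg x i)
  refine le_trans (le_of_eq ?_) h3
  have e1 : ∑ i, p x i * (huberPot K x + 2 * (w x i * s i - w x i / n * ∑ j, s j) +
      (if i ∈ G then (w x i : ℝ) ^ 2 / 4 else 0)) =
      ∑ i, (huberPot K x * p x i + 2 * (s i * (p x i * w x i)) -
        (2 * (∑ j, s j) / n) * (p x i * w x i) +
        (if i ∈ G then p x i * (w x i : ℝ) ^ 2 / 4 else 0)) :=
    Finset.sum_congr rfl fun i _ => by split_ifs <;> ring
  rw [e1, Finset.sum_add_distrib, Finset.sum_sub_distrib, Finset.sum_add_distrib, ← Finset.mul_sum,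
    ← Finset.mul_sum, ← Finset.mul_sum, h.sum_eq_one, mul_one, Finset.sum_ite_mem,
    Finset.univ_inter, Finset.sum_div]
  simp only [drift, mul_sub, Finset.sum_sub_distrib, ← Finset.sum_mul]
  ring

end Potentials

/-! ### The combined potential -/

theorem exp_combination_le {ρ : ℝ} (h0 : 0 ≤ ρ) (h1 : ρ ≤ 1 / 2) (a b c d e : ℝ) :
    Real.exp ((a + b + ρ * (c + d) + e) / 4) ≤ 1 + ((Real.exp a - 1) + (Real.exp b - 1) +
      ρ * ((Real.exp c - 1) + (Real.exp d - 1)) + (Real.exp e - 1)) / 4 := by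
  -- The sixth point 0 absorbs the leftover weight 1/4 - ρ/2, which is nonnegative since ρ ≤ 1/2.
  have h := convexOn_exp.map_sum_le (t := Finset.univ)
    (w := ![1 / 4, 1 / 4, ρ / 4, ρ / 4, 1 / 4, 1 / 4 - ρ / 2]) (p := ![a, b, c, d, e, 0])
    (by intro i _; fin_cases i <;> simp <;> linarith)
    (by simp [Fin.sum_univ_succ]; ring) (fun _ _ => Set.mem_univ _)
  simp [Fin.sum_univ_succ] at h
  refine le_trans (le_of_eq ?_) (h.trans (le_of_eq ?_))
  · congr 1; ring
  · ring

/-- The logarithm of the combined potential. -/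
def logPot (α γ ρ τ : ℝ) {n : ℕ} (x : Load n) : ℝ :=
  (Real.log (expPot α x) + Real.log (expPot (-α) x) +
    ρ * (Real.log (expPot γ x) + Real.log (expPot (-γ) x)) + -(τ * huberPot 3 x / n)) / 4

/-- The one-step ratio of the geometric mean is bounded by the weighted arithmetic mean of the
one-step ratios, so the relative drifts of the components simply add. For the Huber factor, a round
changes the potential by at most 24, whence the error 576τ² = (24τ)². -/
theorem stepOp_exp_logPot_le {n : ℕ} [NeZero n] {p : Load n → Fin n → ℝ}
    {w : Load n → Fin n → ℕ} (h : Admissible p w) {α γ ρ τ : ℝ} (h0 : 0 ≤ ρ) (h1 : ρ ≤ 1 / 2)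
    (hτ0 : 0 ≤ τ) (hτ1 : τ ≤ 1 / 24) (x : Load n) {d₁ d₂ d₃ d₄ d₅ : ℝ}
    (H₁ : stepOp p w (expPot α) x ≤ (1 + d₁ / n) * expPot α x)
    (H₂ : stepOp p w (expPot (-α)) x ≤ (1 + d₂ / n) * expPot (-α) x)
    (H₃ : stepOp p w (expPot γ) x ≤ (1 + d₃ / n) * expPot γ x)
    (H₄ : stepOp p w (expPot (-γ)) x ≤ (1 + d₄ / n) * expPot (-γ) x)
    (H₅ : huberPot 3 x + d₅ ≤ stepOp p w (huberPot 3) x) :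
    stepOp p w (fun x => Real.exp (logPot α γ ρ τ x)) x ≤ Real.exp (logPot α γ ρ τ x) *
      (1 + (d₁ + d₂ + ρ * (d₃ + d₄) + (576 * τ ^ 2 - τ * d₅)) / n / 4) := by
  have hn : (1 : ℝ) ≤ n := by exact_mod_cast Nat.pos_of_ne_zero (NeZero.ne n)
  have hn0 : (0 : ℝ) < n := by linarith
  have hrat : ∀ (a d : ℝ), stepOp p w (expPot a) x ≤ (1 + d / n) * expPot a x →
      ∑ i, p x i * (expPot a (addBalls x i (w x i)) / expPot a x - 1) ≤ d / n := by
    intro a d hd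
    have hΦ := expPot_pos a x
    simp only [mul_sub, Finset.sum_sub_distrib, mul_one, h.sum_eq_one, ← mul_div_assoc,
      ← Finset.sum_div]
    rw [sub_le_iff_le_add, div_le_iff₀ hΦ]
    unfold stepOp at hd
    linarith
  have hH : ∑ i, p x i * (Real.exp (-(τ * (huberPot 3 (addBalls x i (w x i)) - huberPot 3 x) / n))
      - 1) ≤ (576 * τ ^ 2 - τ * d₅) / n := by
    have hi : ∀ i, Real.exp (-(τ * (huberPot 3 (addBalls x i (w x i)) - huberPot 3 x) / n)) - 1 ≤
        -(τ / n) * huberPot 3 (addBalls x i (w x i)) + (τ / n * huberPot 3 x + 576 * τ ^ 2 / n) := by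
      intro i
      have hw : (w x i : ℝ) ≤ 2 := by exact_mod_cast h.le_two x i
      have hL := abs_huberPot_addBalls_sub_le (K := 3) (by norm_num) x i (w x i)
      set D := huberPot 3 (addBalls x i (w x i)) - huberPot 3 x with hD
      have hL' : |D| ≤ 24 := by linarith
      have h24 : |-(τ * D / n)| ≤ 24 * τ / n := by
        rw [abs_neg, abs_div, abs_mul, abs_of_nonneg hτ0, abs_of_pos hn0]
        rw [mul_comm 24 τ]
        gcongr
      have h25 : 24 * τ / n ≤ 24 * τ := div_le_self (by positivity) hn
      have hq := exp_le_quadratic (h24.trans (h25.trans (by linarith)))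
      have hsq : (-(τ * D / n)) ^ 2 ≤ 576 * τ ^ 2 / n := by
        rw [← sq_abs]
        calc |-(τ * D / n)| ^ 2 ≤ (24 * τ / n) ^ 2 := pow_le_pow_left₀ (abs_nonneg _) h24 2
          _ = 576 * τ ^ 2 / n / n := by ring
          _ ≤ _ := div_le_self (by positivity) hn
      have hDe : -(τ * D / n) = -(τ / n) * huberPot 3 (addBalls x i (w x i)) +
          τ / n * huberPot 3 x := by rw [hD]; ring
      linarith
    calc _ ≤ ∑ i, p x i * (-(τ / n) * huberPot 3 (addBalls x i (w x i)) +
          (τ / n * huberPot 3 x + 576 * τ ^ 2 / n)) :=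
        Finset.sum_le_sum fun i _ => mul_le_mul_of_nonneg_left (hi i) (h.nonneg x i)
      _ = -(τ / n) * stepOp p w (huberPot 3) x + (τ / n * huberPot 3 x + 576 * τ ^ 2 / n) :=
        congrFun (stepOp_affine h.sum_eq_one (-(τ / n)) (τ / n * huberPot 3 x + 576 * τ ^ 2 / n)
          (huberPot 3)) x
      _ ≤ -(τ / n) * (huberPot 3 x + d₅) + (τ / n * huberPot 3 x + 576 * τ ^ 2 / n) := by
        have := mul_le_mul_of_nonneg_left H₅ (by positivity : 0 ≤ τ / n)
        linarith
      _ = _ := by ring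
  have hpt : ∀ i, Real.exp (logPot α γ ρ τ (addBalls x i (w x i))) ≤ Real.exp (logPot α γ ρ τ x) *
      (1 + ((expPot α (addBalls x i (w x i)) / expPot α x - 1) +
        (expPot (-α) (addBalls x i (w x i)) / expPot (-α) x - 1) +
        ρ * ((expPot γ (addBalls x i (w x i)) / expPot γ x - 1) +
          (expPot (-γ) (addBalls x i (w x i)) / expPot (-γ) x - 1)) +
        (Real.exp (-(τ * (huberPot 3 (addBalls x i (w x i)) - huberPot 3 x) / n)) - 1)) / 4) := by
    intro i
    set x' := addBalls x i (w x i)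
    have he : ∀ a, Real.exp (Real.log (expPot a x') - Real.log (expPot a x)) =
        expPot a x' / expPot a x := fun a => by
      rw [Real.exp_sub, Real.exp_log (expPot_pos a x'), Real.exp_log (expPot_pos a x)]
    have := exp_combination_le h0 h1 (Real.log (expPot α x') - Real.log (expPot α x))
      (Real.log (expPot (-α) x') - Real.log (expPot (-α) x))
      (Real.log (expPot γ x') - Real.log (expPot γ x))
      (Real.log (expPot (-γ) x') - Real.log (expPot (-γ) x))
      (-(τ * (huberPot 3 x' - huberPot 3 x) / n))
    rw [he, he, he, he] at this
    refine le_trans (le_of_eq ?_) (mul_le_mul_of_nonneg_left this (Real.exp_pos _).le)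
    rw [← Real.exp_add]
    congr 1
    simp only [logPot]
    ring
  have hsum := Finset.sum_le_sum fun i (_ : i ∈ Finset.univ) =>
    mul_le_mul_of_nonneg_left (hpt i) (h.nonneg x i)
  refine hsum.trans ?_
  have e : ∀ A B C D E : Fin n → ℝ, ∑ i, p x i * (Real.exp (logPot α γ ρ τ x) *
      (1 + (A i + B i + ρ * (C i + D i) + E i) / 4)) = Real.exp (logPot α γ ρ τ x) *
      (∑ i, p x i + (∑ i, p x i * A i + ∑ i, p x i * B i + ρ * (∑ i, p x i * C i +
        ∑ i, p x i * D i) + ∑ i, p x i * E i) / 4) := by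
    intro A B C D E
    simp only [← Finset.sum_add_distrib, Finset.mul_sum, Finset.sum_div]
    exact Finset.sum_congr rfl fun i _ => by ring
  rw [e, h.sum_eq_one]
  refine mul_le_mul_of_nonneg_left ?_ (Real.exp_pos _).le
  have k1 := hrat _ _ H₁
  have k2 := hrat _ _ H₂
  have k34 := mul_le_mul_of_nonneg_left (add_le_add (hrat _ _ H₃) (hrat _ _ H₄)) h0
  have : (d₁ + d₂ + ρ * (d₃ + d₄) + (576 * τ ^ 2 - τ * d₅)) / n =
      d₁ / n + d₂ / n + ρ * (d₃ / n + d₄ / n) + (576 * τ ^ 2 - τ * d₅) / n := by ring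
  rw [this]
  linarith

/-! ### Upper bound on the gap from a drift condition -/

section Finish

variable {n : ℕ}

theorem exists_gap_eq_dev [NeZero n] (x : Load n) : ∃ i, gap x = dev x i := by
  obtain ⟨i, -, hi⟩ := Finset.exists_mem_eq_sup' (Finset.univ_nonempty (α := Fin n)) x
  exact ⟨i, by rw [gap, hi, dev]⟩

theorem log_expPot_nonneg [NeZero n] (a : ℝ) (x : Load n) : 0 ≤ Real.log (expPot a x) :=
  Real.log_nonneg (le_trans (by exact_mod_cast Nat.pos_of_ne_zero (NeZero.ne n))
    (card_le_expPot a x))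

theorem mul_abs_dev_le_log_expPot [NeZero n] (α : ℝ) (x : Load n) (i : Fin n) :
    α * |dev x i| ≤ Real.log (expPot α x) + Real.log (expPot (-α) x) := by
  have h1 : α * dev x i ≤ Real.log (expPot α x) :=
    (Real.le_log_iff_exp_le (expPot_pos α x)).2 (exp_le_expPot α x i)
  have h2 : -α * dev x i ≤ Real.log (expPot (-α) x) :=
    (Real.le_log_iff_exp_le (expPot_pos (-α) x)).2 (exp_le_expPot (-α) x i)
  have h3 := log_expPot_nonneg α x
  have h4 := log_expPot_nonneg (-α) x
  rcases abs_cases (dev x i) with ⟨h, -⟩ | ⟨h, -⟩ <;> rw [h] <;> linarith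

/-- The Huber term enters with a negative sign but grows only linearly in the deviations. With 12τ ≤
α it consumes at most half of the logarithms of the two α-potentials. -/
theorem mul_abs_dev_le_logPot [NeZero n] {α γ ρ τ : ℝ} (hα : 0 < α) (hρ : 0 ≤ ρ) (hτ : 0 ≤ τ)
    (hτα : 12 * τ ≤ α) (x : Load n) (i : Fin n) : α / 8 * |dev x i| ≤ logPot α γ ρ τ x := by
  have hn : (0 : ℝ) < n := by exact_mod_cast Nat.pos_of_ne_zero (NeZero.ne n)
  set L := Real.log (expPot α x) + Real.log (expPot (-α) x) with hL
  have hi := mul_abs_dev_le_log_expPot α x i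
  have hH : huberPot 3 x ≤ n * (6 * (L / α)) := by
    calc huberPot 3 x ≤ ∑ _j : Fin n, 6 * (L / α) := by
          refine Finset.sum_le_sum fun j _ => (huber_le (by norm_num) _).trans ?_
          have : |dev x j| ≤ L / α := by
            rw [le_div_iff₀ hα, mul_comm]; exact mul_abs_dev_le_log_expPot α x j
          linarith
      _ = _ := by simp
  have hτH : τ * huberPot 3 x / n ≤ L / 2 := by
    rw [div_le_iff₀ hn]
    have hL0 : 0 ≤ L := add_nonneg (log_expPot_nonneg _ x) (log_expPot_nonneg _ x)
    calc τ * huberPot 3 x ≤ τ * (n * (6 * (L / α))) := mul_le_mul_of_nonneg_left hH hτ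
      _ = (12 * τ) * (L / α) / 2 * n := by ring
      _ ≤ α * (L / α) / 2 * n := by gcongr
      _ = L / 2 * n := by field_simp
  have h1 := mul_nonneg hρ (add_nonneg (log_expPot_nonneg γ x) (log_expPot_nonneg (-γ) x))
  unfold logPot
  linarith

/-- Small α-potentials already confine all deviations to order log n, which also bounds the
γ-potentials polynomially. Hence V is polynomial in n wherever it is not required to contract. -/
theorem logPot_le_of_expPot_le [NeZero n] {α γ ρ τ : ℝ} (hα : 0 < α) (hγ : 0 ≤ γ) (hρ : 0 ≤ ρ)
    (hτ : 0 ≤ τ) (x : Load n) (h1 : expPot α x ≤ 2 * n) (h2 : expPot (-α) x ≤ 2 * n) :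
    logPot α γ ρ τ x ≤ (1 + ρ * (1 + 2 * γ / α)) * Real.log (2 * n) := by
  have hn : (1 : ℝ) ≤ n := by exact_mod_cast Nat.pos_of_ne_zero (NeZero.ne n)
  have l1 : Real.log (expPot α x) ≤ Real.log (2 * n) := Real.log_le_log (expPot_pos _ x) h1
  have l2 : Real.log (expPot (-α) x) ≤ Real.log (2 * n) := Real.log_le_log (expPot_pos _ x) h2
  have hdev : ∀ i, |dev x i| ≤ 2 * Real.log (2 * n) / α := fun i => by
    rw [le_div_iff₀ hα, mul_comm]
    linarith [mul_abs_dev_le_log_expPot α x i]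
  have hl0 : 0 ≤ Real.log (2 * n) := Real.log_nonneg (by linarith)
  have hγs : ∀ a, |a| = γ → Real.log (expPot a x) ≤ (1 + 2 * γ / α) * Real.log (2 * n) := by
    intro a ha
    rw [Real.log_le_iff_le_exp (expPot_pos a x)]
    calc expPot a x ≤ ∑ _i : Fin n, Real.exp (γ * (2 * Real.log (2 * n) / α)) := by
          refine Finset.sum_le_sum fun i _ => Real.exp_le_exp.2 ((le_abs_self _).trans ?_)
          rw [abs_mul, ha]
          exact mul_le_mul_of_nonneg_left (hdev i) hγ
      _ = n * Real.exp (γ * (2 * Real.log (2 * n) / α)) := by simp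
      _ ≤ Real.exp (Real.log (2 * n)) * Real.exp (γ * (2 * Real.log (2 * n) / α)) := by
          rw [Real.exp_log (by linarith)]
          gcongr
          linarith
      _ = _ := by rw [← Real.exp_add]; congr 1; ring
  have l3 := hγs γ (abs_of_nonneg hγ)
  have l4 := hγs (-γ) (by rw [abs_neg, abs_of_nonneg hγ])
  have h5 : 0 ≤ τ * huberPot 3 x / n := by
    have := huberPot_nonneg (K := 3) (by norm_num) x
    positivity
  have h6 := mul_le_mul_of_nonneg_left (add_le_add l3 l4) hρ
  unfold logPot
  have h7 : 0 ≤ (1 + 2 * γ / α) * Real.log (2 * n) := by positivity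
  have h8 := mul_nonneg hρ h7
  linarith

/-- The constant in the upper bound. -/
def gapConst (α γ ρ c D : ℝ) : ℝ :=
  8 / α * (2 * (1 + ρ * (1 + 2 * γ / α)) + 1 + 2 * Real.log (1 + (D + c) / c) + 4)

-- Foster–Lyapunov argument followed by Markov's inequality: V has contraction rate c/n outside a
-- region where it is polynomial in n, and a gap above K log n forces V to exceed a larger power of
-- n.
open Classical in
theorem stepOp_iterate_gap_le [NeZero n] (hn2 : 2 ≤ n) {p : Load n → Fin n → ℝ}
    {w : Load n → Fin n → ℕ} (h : Admissible p w) {α γ ρ τ c D : ℝ} (hα : 0 < α) (hγ : 0 ≤ γ)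
    (hρ : 0 ≤ ρ) (hτ : 0 ≤ τ) (hτα : 12 * τ ≤ α) (hc : 0 < c) (hc1 : c ≤ 1) (hD : 0 ≤ D)
    (hdrop : ∀ x : Load n, 2 * n ≤ expPot α x ∨ 2 * n ≤ expPot (-α) x →
      stepOp p w (fun x => Real.exp (logPot α γ ρ τ x)) x ≤
        Real.exp (logPot α γ ρ τ x) * (1 - c / n))
    (hgrow : ∀ x : Load n, stepOp p w (fun x => Real.exp (logPot α γ ρ τ x)) x ≤
        Real.exp (logPot α γ ρ τ x) * (1 + D / n)) (m : ℕ) :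
    (stepOp p w)^[m] (fun x => if gapConst α γ ρ c D * Real.log n < gap x then 1 else 0) 0 ≤
      ((n : ℝ) ^ 4)⁻¹ := by
  have hn : (2 : ℝ) ≤ n := by exact_mod_cast hn2
  have hn0 : (0 : ℝ) < n := by linarith
  set K := gapConst α γ ρ c D with hK
  set E := 1 + ρ * (1 + 2 * γ / α) with hE
  have hE0 : 0 ≤ E := by positivity
  set V : Load n → ℝ := fun x => Real.exp (logPot α γ ρ τ x) with hV
  set B := Real.exp (E * Real.log (2 * n)) with hB
  set A := B * (D + c) with hA
  have hl2 : (1 / 2 : ℝ) ≤ Real.log n := by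
    have h1 := Real.log_two_gt_d9
    have h2 := Real.log_le_log (by norm_num : (0 : ℝ) < 2) hn
    linarith
  have hV1 : ∀ x, stepOp p w V x ≤ (1 - c / n) * V x + A := by
    intro x
    by_cases hx : 2 * n ≤ expPot α x ∨ 2 * n ≤ expPot (-α) x
    · have := hdrop x hx
      have hA0 : 0 ≤ A := by positivity
      linarith
    · push Not at hx
      have hVB : V x ≤ B :=
        Real.exp_le_exp.2 (logPot_le_of_expPot_le hα hγ hρ hτ x hx.1.le hx.2.le)
      have h1 : V x * ((D + c) / n) ≤ A :=
        mul_le_mul hVB (div_le_self (by positivity) (by linarith)) (by positivity)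
          (Real.exp_pos _).le
      calc _ ≤ _ := hgrow x
        _ = (1 - c / n) * V x + V x * ((D + c) / n) := by ring
        _ ≤ _ := by linarith
  have hV0 : V 0 ≤ B := by
    have hz : ∀ a, expPot a (0 : Load n) = n := by intro a; simp [expPot, dev, totalLoad]
    exact Real.exp_le_exp.2 (logPot_le_of_expPot_le hα hγ hρ hτ 0
      (by rw [hz]; linarith) (by rw [hz]; linarith))
  have hit := stepOp_iterate_le_of_drift h.nonneg h.sum_eq_one (V := V) (r := c / n) (A := A)
    (by positivity) (by rw [div_le_one hn0]; linarith) (by positivity) hV1 m 0 (Real.exp_pos _).le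
  have hind : ∀ x : Load n, (if K * Real.log n < gap x then (1 : ℝ) else 0) ≤
      Real.exp (-(α / 8 * K * Real.log n)) * V x + 0 := by
    intro x
    split_ifs with hx
    · rw [add_zero, hV, ← Real.exp_add]
      obtain ⟨i, hi⟩ := exists_gap_eq_dev x
      have h1 := mul_abs_dev_le_logPot (γ := γ) hα hρ hτ hτα x i
      have h2 := mul_le_mul_of_nonneg_left (hx.le.trans (hi.le.trans (le_abs_self _)))
        (by positivity : 0 ≤ α / 8)
      exact Real.one_le_exp (by linarith)
    · have := mul_pos (Real.exp_pos (-(α / 8 * K * Real.log n))) (Real.exp_pos (logPot α γ ρ τ x))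
      simp only [hV]; linarith
  have h1 := stepOp_iterate_mono (w := w) h.nonneg m hind 0
  rw [stepOp_iterate_affine h.sum_eq_one, add_zero] at h1
  refine h1.trans ?_
  have hF : 0 < 1 + (D + c) / c := by positivity
  have hF1 : 0 ≤ Real.log (1 + (D + c) / c) := Real.log_nonneg (by
    have : 0 ≤ (D + c) / c := by positivity
    linarith)
  have h2 : V 0 + A / (c / n) ≤ B * (n * (1 + (D + c) / c)) := by
    have : A / (c / n) = B * (n * ((D + c) / c)) := by rw [hA]; field_simp
    have hBpos : 0 < B := Real.exp_pos _
    rw [this]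
    nlinarith
  -- Since log n ≥ 1/2, the constant factor 1 + (D + c)/c is at most n to the power 2 log(1 + (D +
  -- c)/c). This explains the summands of `gapConst`; its final 4 yields the target n⁻⁴.
  have h3 : B * (n * (1 + (D + c) / c)) ≤
      Real.exp ((2 * E + 1 + 2 * Real.log (1 + (D + c) / c)) * Real.log n) := by
    have e1 : B ≤ Real.exp (2 * E * Real.log n) := by
      refine Real.exp_le_exp.2 ?_
      have : Real.log (2 * n) ≤ 2 * Real.log n := by
        rw [Real.log_mul (by norm_num) hn0.ne', two_mul]
        gcongr
      nlinarith
    have e2 : (n : ℝ) = Real.exp (Real.log n) := (Real.exp_log hn0).symm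
    have e3 : 1 + (D + c) / c ≤ Real.exp (2 * Real.log (1 + (D + c) / c) * Real.log n) := by
      rw [← Real.log_le_iff_le_exp hF]
      nlinarith
    calc B * (n * (1 + (D + c) / c)) ≤ Real.exp (2 * E * Real.log n) *
          (Real.exp (Real.log n) * Real.exp (2 * Real.log (1 + (D + c) / c) * Real.log n)) := by
          rw [← e2]
          gcongr
      _ = _ := by rw [← Real.exp_add, ← Real.exp_add]; congr 1; ring
  calc _ ≤ Real.exp (-(α / 8 * K * Real.log n)) *
        Real.exp ((2 * E + 1 + 2 * Real.log (1 + (D + c) / c)) * Real.log n) :=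
        mul_le_mul_of_nonneg_left (hit.trans (h2.trans h3)) (Real.exp_pos _).le
    _ = Real.exp (-(4 * Real.log n)) := by
        rw [← Real.exp_add]
        congr 1
        rw [hK, gapConst, ← hE]
        field_simp
        ring
    _ = _ := by
        rw [Real.exp_neg]
        congr 1
        rw [show (4 : ℝ) = (4 : ℕ) by norm_num, Real.exp_nat_mul, Real.exp_log hn0]

theorem one_sub_le_gapProb [NeZero n] {Q : AllocProcess} {p : Load n → Fin n → ℝ}
    {w : Load n → Fin n → ℕ} (hQ : Represents Q n p w) (h : Admissible p w) (m : ℕ)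
    (S T : ℝ → Prop) (hST : ∀ g, T g ↔ ¬ S g) {b : ℝ}
    (hb : gapProb Q n m S ≤ b) : 1 - b ≤ gapProb Q n m T := by
  classical
  rw [gapProb_eq hQ h.nonneg] at hb ⊢
  have e : (fun x : Load n => if T (gap x) then (1 : ℝ) else 0) =
      fun x => (-1) * (if S (gap x) then (1 : ℝ) else 0) + 1 := by
    funext x
    by_cases hS : S (gap x) <;> simp [hST, hS]
  rw [e, stepOp_iterate_affine h.sum_eq_one]
  linarith

end Finish

/-! ### Mean-biased processes -/

/-- Weights under which a bin drifts away from the mean only through the fraction of bins on its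
own side of the mean. -/
structure MeanBiased {n : ℕ} (p : Load n → Fin n → ℝ) (w : Load n → Fin n → ℕ) : Prop
    extends Admissible p w where
  drift_under : ∀ x i, dev x i < 0 → drift p w x i = overFrac x / n
  drift_over : ∀ x i, 0 ≤ dev x i → drift p w x i = -(1 - overFrac x) / n
  le_mul_sq_under : ∀ x i, dev x i < 0 → 1 / n ≤ p x i * (w x i : ℝ) ^ 2
  le_mul_sq_over : ∀ x i, 0 ≤ dev x i → overFrac x / n ≤ p x i * (w x i : ℝ) ^ 2

section MeanBiased

variable {n : ℕ} {p : Load n → Fin n → ℝ} {w : Load n → Fin n → ℕ}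

theorem card_under_div [NeZero n] (x : Load n) :
    ((Finset.univ.filter fun i => dev x i < 0).card : ℝ) / n = 1 - overFrac x := by
  have hn : (n : ℝ) ≠ 0 := by exact_mod_cast NeZero.ne n
  have h := Finset.card_filter_add_card_filter_not (s := (Finset.univ : Finset (Fin n)))
    (fun i => 0 ≤ dev x i)
  simp only [not_le, Finset.card_univ, Fintype.card_fin] at h
  have h' : ((Finset.univ.filter fun i => 0 ≤ dev x i).card : ℝ) +
    ((Finset.univ.filter fun i => dev x i < 0).card : ℝ) = n := by exact_mod_cast h
  rw [overFrac]
  field_simp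
  linarith

theorem overFrac_nonneg (x : Load n) : 0 ≤ overFrac x := by unfold overFrac; positivity

theorem overFrac_le_one [NeZero n] (x : Load n) : overFrac x ≤ 1 := by
  have h : (0 : ℝ) ≤ ((Finset.univ.filter fun i => dev x i < 0).card : ℝ) / n := by positivity
  rw [card_under_div] at h
  linarith

/-- Off `O` the bias δ/n equals -(1-δ)/n + 1/n, and there exp(u) ≤ 1. All bins thus share the bias
-(1-δ)/n, at an extra cost of at most 1/n for each of the (1-δ)n bins off `O`. -/
theorem sum_biased_exp_le [NeZero n] (O : Finset (Fin n)) (u : Fin n → ℝ)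
    (hu : ∀ i, i ∉ O → u i ≤ 0) {δ : ℝ} (hδ : (O.card : ℝ) / n = δ) :
    ∑ i, (if i ∈ O then -(1 - δ) / n else δ / n) * Real.exp (u i) ≤
      -(1 - δ) / n * (∑ i, Real.exp (u i) - n) := by
  classical
  have hn : (0 : ℝ) < n := by exact_mod_cast Nat.pos_of_ne_zero (NeZero.ne n)
  have h1 : ∀ i, (if i ∈ O then -(1 - δ) / n else δ / n) * Real.exp (u i) ≤
      -(1 - δ) / n * Real.exp (u i) + 1 / n * (1 - if i ∈ O then 1 else 0) := by
    intro i
    split_ifs with hi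
    · simp
    · have := Real.exp_le_one_iff.2 (hu i hi)
      have h2 := mul_le_mul_of_nonneg_left this (by positivity : 0 ≤ 1 / (n : ℝ))
      calc δ / n * Real.exp (u i)
          = -(1 - δ) / n * Real.exp (u i) + 1 / n * Real.exp (u i) := by ring
        _ ≤ _ := by linarith
  refine (Finset.sum_le_sum fun i _ => h1 i).trans (le_of_eq ?_)
  rw [Finset.sum_add_distrib, ← Finset.mul_sum, ← Finset.mul_sum, Finset.sum_sub_distrib]
  simp only [Finset.sum_const, Finset.card_univ, Fintype.card_fin, Finset.sum_boole,
    Finset.filter_mem_eq_inter, Finset.univ_inter, nsmul_eq_mul, mul_one]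
  rw [← hδ]
  field_simp
  ring

theorem MeanBiased.sum_drift_le [NeZero n] (h : MeanBiased p w) {a : ℝ} (ha : 0 ≤ a)
    (x : Load n) : a * ∑ i, drift p w x i * Real.exp (a * dev x i) ≤
      -(a * (1 - overFrac x)) / n * (expPot a x - n) := by
  have h1 := sum_biased_exp_le (Finset.univ.filter fun i => 0 ≤ dev x i) (fun i => a * dev x i)
    (fun i hi => by
      simp only [Finset.mem_filter, Finset.mem_univ, true_and, not_le] at hi
      nlinarith) rfl
  have h2 : ∑ i, drift p w x i * Real.exp (a * dev x i) ≤
      -(1 - overFrac x) / n * (expPot a x - n) := by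
    refine le_trans (le_of_eq (Finset.sum_congr rfl fun i _ => ?_)) h1
    congr 1
    by_cases hi : 0 ≤ dev x i
    · rw [if_pos (by simpa using hi), h.drift_over x i hi, overFrac]
    · rw [if_neg (by simpa using hi), h.drift_under x i (not_le.1 hi), overFrac]
  calc _ ≤ _ := mul_le_mul_of_nonneg_left h2 ha
    _ = _ := by ring

theorem MeanBiased.sum_drift_neg_le [NeZero n] (h : MeanBiased p w) {a : ℝ} (ha : 0 ≤ a)
    (x : Load n) : -a * ∑ i, drift p w x i * Real.exp (-a * dev x i) ≤
      -(a * overFrac x) / n * (expPot (-a) x - n) := by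
  have h1 := sum_biased_exp_le (Finset.univ.filter fun i => dev x i < 0) (fun i => -a * dev x i)
    (fun i hi => by
      simp only [Finset.mem_filter, Finset.mem_univ, true_and, not_lt] at hi
      nlinarith) (card_under_div x)
  have h2 : ∑ i, -drift p w x i * Real.exp (-a * dev x i) ≤
      -overFrac x / n * (expPot (-a) x - n) := by
    refine le_trans (le_of_eq (Finset.sum_congr rfl fun i _ => ?_)) (h1.trans (le_of_eq ?_))
    · congr 1
      by_cases hi : dev x i < 0
      · rw [if_pos (by simpa using hi), h.drift_under x i hi]; ring
      · rw [if_neg (by simpa using hi), h.drift_over x i (not_lt.1 hi)]; ring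
    · rw [expPot]; ring
  calc -a * ∑ i, drift p w x i * Real.exp (-a * dev x i)
      = a * ∑ i, -drift p w x i * Real.exp (-a * dev x i) := by
        simp only [neg_mul, Finset.sum_neg_distrib, mul_neg]
    _ ≤ _ := mul_le_mul_of_nonneg_left h2 ha
    _ = _ := by ring

/-- `R` is a lower bound on the relative excess of the potential over its minimum n: 0 is always
allowed, 1/2 when the potential is at least 2n, and 3/4 when it is at least 4n. -/
theorem growth_le_of_sum_drift_le [NeZero n] (h : Admissible p w) {a b f R : ℝ} (ha : |a| ≤ 1 / 4)
    (hb : 0 ≤ b) (hf : 0 ≤ f) (x : Load n)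
    (hS : a * ∑ i, drift p w x i * Real.exp (a * dev x i) ≤ -(b * f) / n * (expPot a x - n))
    (hR : n ≤ (1 - R) * expPot a x) :
    stepOp p w (expPot a) x ≤ (1 + (8 * a ^ 2 - b * (f * R)) / n) * expPot a x := by
  have hn : (0 : ℝ) < n := by exact_mod_cast Nat.pos_of_ne_zero (NeZero.ne n)
  have h1 := stepOp_expPot_le h ha x
  have h2 : R * expPot a x ≤ expPot a x - n := by linarith
  have h3 := mul_le_mul_of_nonneg_left h2 (by positivity : 0 ≤ b * f / n)
  calc _ ≤ _ := h1
    _ ≤ (1 + 8 * a ^ 2 / n) * expPot a x - b * f / n * (R * expPot a x) := by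
      have : -(b * f) / n * (expPot a x - n) = -(b * f / n * (expPot a x - n)) := by ring
      linarith
    _ = _ := by ring

theorem MeanBiased.stepOp_expPot_le [NeZero n] (h : MeanBiased p w) {a : ℝ} (ha : 0 ≤ a)
    (ha4 : a ≤ 1 / 4) (x : Load n) {R : ℝ} (hR : n ≤ (1 - R) * expPot a x) :
    stepOp p w (expPot a) x ≤
      (1 + (8 * a ^ 2 - a * ((1 - overFrac x) * R)) / n) * expPot a x :=
  growth_le_of_sum_drift_le h.toAdmissible (by rwa [abs_of_nonneg ha]) ha
    (by linarith [overFrac_le_one x]) x (h.sum_drift_le ha x) hR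

theorem MeanBiased.stepOp_expPot_neg_le [NeZero n] (h : MeanBiased p w) {a : ℝ} (ha : 0 ≤ a)
    (ha4 : a ≤ 1 / 4) (x : Load n) {R : ℝ} (hR : n ≤ (1 - R) * expPot (-a) x) :
    stepOp p w (expPot (-a)) x ≤
      (1 + (8 * a ^ 2 - a * (overFrac x * R)) / n) * expPot (-a) x := by
  have := growth_le_of_sum_drift_le h.toAdmissible (a := -a) (by rwa [abs_neg, abs_of_nonneg ha])
    ha (overFrac_nonneg x) x (h.sum_drift_neg_le ha x) hR
  rwa [neg_sq] at this

/-- If most bins lie on one side of the mean, then many of them are close to it or the bins on the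
other side are far away on average. -/
theorem expPot_large_or_many_close [NeZero n] (O : Finset (Fin n)) (u : Fin n → ℝ)
    {γ : ℝ} (hγ0 : 0 < γ) (hγ1 : γ ≤ 1) (hsum : ∑ i, u i = 0) (hO : ∀ i ∈ O, 0 ≤ u i)
    (hOc : ∀ i, i ∉ O → u i ≤ 0) (hcard : (1 - γ ^ 2 / 128) * n ≤ O.card) :
    4 * (n : ℝ) ≤ ∑ i, Real.exp (-γ * u i) ∨
      ∃ G ⊆ O, (n : ℝ) / 2 ≤ G.card ∧ ∀ j ∈ G, |u j| ≤ 1 := by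
  classical
  have hn : (0 : ℝ) < n := by exact_mod_cast Nat.pos_of_ne_zero (NeZero.ne n)
  -- If a quarter of the bins have u ≥ 1, then, as the sum vanishes, the at most γ²n/128 bins off
  -- `O` carry a total deficit of at least n/4, so the average deficit there is at least 32/γ².
  by_cases hF : (n : ℝ) / 4 ≤ (O.filter fun i => 1 ≤ u i).card
  · left
    have h1 : (n : ℝ) / 4 ≤ ∑ i ∈ O, u i := by
      calc (n : ℝ) / 4 ≤ (O.filter fun i => 1 ≤ u i).card := hF
        _ = ∑ i ∈ O.filter (fun i => 1 ≤ u i), (1 : ℝ) := by simp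
        _ ≤ ∑ i ∈ O.filter (fun i => 1 ≤ u i), u i :=
          Finset.sum_le_sum fun i hi => (Finset.mem_filter.1 hi).2
        _ ≤ ∑ i ∈ O, u i := Finset.sum_le_sum_of_subset_of_nonneg (Finset.filter_subset _ _)
          fun i hi _ => hO i hi
    have h2 : ∑ i ∈ Oᶜ, -u i = ∑ i ∈ O, u i := by
      rw [Finset.sum_neg_distrib]
      have := Finset.sum_add_sum_compl O u
      linarith
    have hc : (Oᶜ.card : ℝ) ≤ γ ^ 2 / 128 * n := by
      rw [Finset.card_compl, Fintype.card_fin,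
        Nat.cast_sub (by simpa using Finset.card_le_univ O)]
      linarith
    -- Tangent of γ²v²/2 at that average deficit v = 32/γ²; summing these linear bounds gives 8n -
    -- 4n = 4n.
    have h3 : ∀ i ∈ Oᶜ, γ ^ 2 * (32 / γ ^ 2 * -u i - (32 / γ ^ 2) ^ 2 / 2) ≤
        Real.exp (-γ * u i) := by
      intro i hi
      have hv := hOc i (Finset.mem_compl.1 hi)
      have h4 := Real.quadratic_le_exp_of_nonneg (x := -γ * u i) (by nlinarith)
      have h5 : γ ^ 2 * (32 / γ ^ 2 * -u i - (32 / γ ^ 2) ^ 2 / 2) ≤ (-γ * u i) ^ 2 / 2 := by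
        nlinarith [mul_nonneg (sq_nonneg γ) (sq_nonneg (-u i - 32 / γ ^ 2))]
      have h6 : 0 ≤ -γ * u i := by nlinarith
      linarith
    calc 4 * (n : ℝ) = 32 * (n / 4) - 512 / γ ^ 2 * (γ ^ 2 / 128 * n) := by field_simp; ring
      _ ≤ 32 * ∑ i ∈ Oᶜ, -u i - 512 / γ ^ 2 * Oᶜ.card := by
        rw [h2]
        gcongr
      _ = ∑ i ∈ Oᶜ, γ ^ 2 * (32 / γ ^ 2 * -u i - (32 / γ ^ 2) ^ 2 / 2) := by
        rw [← Finset.mul_sum, Finset.sum_sub_distrib, ← Finset.mul_sum, Finset.sum_const,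
          nsmul_eq_mul]
        field_simp
        ring
      _ ≤ ∑ i ∈ Oᶜ, Real.exp (-γ * u i) := Finset.sum_le_sum h3
      _ ≤ _ := Finset.sum_le_sum_of_subset_of_nonneg (Finset.subset_univ _)
          fun i _ _ => (Real.exp_pos _).le
  · right
    refine ⟨O.filter fun i => ¬ 1 ≤ u i, Finset.filter_subset _ _, ?_, fun j hj => ?_⟩
    · have h1 : ((O.filter fun i => 1 ≤ u i).card : ℝ) + (O.filter fun i => ¬ 1 ≤ u i).card =
          O.card := by exact_mod_cast Finset.card_filter_add_card_filter_not _
      have h2 : γ ^ 2 * n ≤ 1 * n :=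
        mul_le_mul_of_nonneg_right (pow_le_one₀ hγ0.le hγ1) hn.le
      linarith
    · obtain ⟨hjO, hj⟩ := Finset.mem_filter.1 hj
      rw [abs_of_nonneg (hO j hjO)]
      linarith

/-- Clamped deviations are at most K in absolute value, and the absolute drifts on each side of the
mean sum to δ(1-δ). The first-order loss is therefore small when δ is near 0 or 1, exactly where the
fluctuation gain is needed. -/
theorem MeanBiased.le_stepOp_huberPot [NeZero n] (h : MeanBiased p w) (hn2 : 2 ≤ n) {K : ℝ}
    (hK : 0 ≤ K) (x : Load n) (G : Finset (Fin n)) (hG : ∀ j ∈ G, |dev x j| ≤ K - 2) :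
    huberPot K x + (-(4 * K * (overFrac x * (1 - overFrac x))) +
      (∑ j ∈ G, p x j * w x j ^ 2) / 4) ≤ stepOp p w (huberPot K) x := by
  have hn : (0 : ℝ) < n := by exact_mod_cast Nat.pos_of_ne_zero (NeZero.ne n)
  refine le_trans ?_ (BallsBins.le_stepOp_huberPot h.toAdmissible hn2 hK x G hG)
  have h0 := overFrac_nonneg x
  have h1 := overFrac_le_one x
  have hj : ∀ j, -K * (if 0 ≤ dev x j then (1 - overFrac x) / n else 0) +
      -K * (if dev x j < 0 then overFrac x / n else 0) ≤
      max (-K) (min (dev x j) K) * drift p w x j := by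
    intro j
    obtain ⟨l1, l2⟩ := abs_le.1 (abs_clamp_le hK (dev x j))
    by_cases hd : 0 ≤ dev x j
    · rw [if_pos hd, if_neg (not_lt.2 hd), h.drift_over x j hd, mul_zero, add_zero, neg_div,
        mul_neg, neg_mul]
      have : 0 ≤ (1 - overFrac x) / n := by
        have : 0 ≤ 1 - overFrac x := by linarith
        positivity
      exact neg_le_neg (mul_le_mul_of_nonneg_right l2 this)
    · rw [if_neg hd, if_pos (not_le.1 hd), h.drift_under x j (not_le.1 hd), mul_zero, zero_add]
      exact mul_le_mul_of_nonneg_right l1 (by positivity)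
  have hs := Finset.sum_le_sum fun j (_ : j ∈ Finset.univ) => hj j
  rw [Finset.sum_add_distrib, ← Finset.mul_sum, ← Finset.mul_sum, ← Finset.sum_filter,
    ← Finset.sum_filter, Finset.sum_const, Finset.sum_const, nsmul_eq_mul, nsmul_eq_mul] at hs
  have e1 : ((Finset.univ.filter fun i => 0 ≤ dev x i).card : ℝ) * ((1 - overFrac x) / n) =
      overFrac x * (1 - overFrac x) := by rw [overFrac]; ring
  have e2 : ((Finset.univ.filter fun i => dev x i < 0).card : ℝ) * (overFrac x / n) =
      overFrac x * (1 - overFrac x) := by rw [← card_under_div]; ring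
  rw [e1, e2] at hs
  linarith

end MeanBiased

/-! ### Contraction of the combined potential for mean-biased kernels -/

section MeanBiased

variable {n : ℕ} {p : Load n → Fin n → ℝ} {w : Load n → Fin n → ℕ}

theorem MeanBiased.huberPot_drift_of_close [NeZero n] (h : MeanBiased p w) (hn2 : 2 ≤ n)
    (x : Load n) {K η b : ℝ} (hK : 0 ≤ K) (hη : 4 * K * (overFrac x * (1 - overFrac x)) ≤ η)
    (G : Finset (Fin n)) (hG : ∀ j ∈ G, |dev x j| ≤ K - 2) (hcard : (n : ℝ) / 2 ≤ G.card)
    (hb : 0 ≤ b) (hpw : ∀ j ∈ G, b / n ≤ p x j * w x j ^ 2) :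
    huberPot K x + (b / 8 - η) ≤ stepOp p w (huberPot K) x := by
  have hn : (0 : ℝ) < n := by exact_mod_cast Nat.pos_of_ne_zero (NeZero.ne n)
  refine le_trans ?_ (h.le_stepOp_huberPot hn2 hK x G hG)
  have h1 := Finset.card_nsmul_le_sum G _ _ hpw
  rw [nsmul_eq_mul] at h1
  have h2 : (n : ℝ) / 2 * (b / n) ≤ G.card * (b / n) :=
    mul_le_mul_of_nonneg_right hcard (by positivity)
  have h3 : (n : ℝ) / 2 * (b / n) = b / 2 := by field_simp
  linarith

theorem MeanBiased.huberPot_drift [NeZero n] (h : MeanBiased p w) (hn2 : 2 ≤ n)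
    (x : Load n) {K η : ℝ} (hK : 0 ≤ K) (hη : 4 * K * (overFrac x * (1 - overFrac x)) ≤ η) :
    huberPot K x + -η ≤ stepOp p w (huberPot K) x := by
  refine le_trans ?_ (h.le_stepOp_huberPot hn2 hK x ∅ (by simp))
  simp only [Finset.sum_empty, zero_div]
  linarith

theorem overFrac_mul_le (x : Load n) : overFrac x * (1 - overFrac x) ≤ 1 / 4 := by
  nlinarith [sq_nonneg (overFrac x - 1 / 2)]

/-- The parameters α = 2⁻⁵⁷, γ = 2⁻¹⁶, ρ = 2⁻⁸⁰, τ = 2⁻¹⁰¹ are chosen so that in each regime one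
gain beats all errors. The errors are 16α² = 2⁻¹¹⁰, 16ργ² = 2⁻¹⁰⁸, and a Huber loss of at most 3τ in
general and τ/32 for extreme δ. The required drop 4 · 2⁻¹¹¹ is smaller still. -/
theorem MeanBiased.logPot_drift [NeZero n] (h : MeanBiased p w) (hn2 : 2 ≤ n) (x : Load n) :
    (2 * n ≤ expPot (1 / 2 ^ 57) x ∨ 2 * n ≤ expPot (-(1 / 2 ^ 57)) x →
      stepOp p w (fun x => Real.exp (logPot (1 / 2 ^ 57) (1 / 2 ^ 16) (1 / 2 ^ 80)
        (1 / 2 ^ 101) x)) x ≤ Real.exp (logPot (1 / 2 ^ 57) (1 / 2 ^ 16) (1 / 2 ^ 80)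
        (1 / 2 ^ 101) x) * (1 - 1 / 2 ^ 111 / n)) ∧
    stepOp p w (fun x => Real.exp (logPot (1 / 2 ^ 57) (1 / 2 ^ 16) (1 / 2 ^ 80)
        (1 / 2 ^ 101) x)) x ≤ Real.exp (logPot (1 / 2 ^ 57) (1 / 2 ^ 16) (1 / 2 ^ 80)
        (1 / 2 ^ 101) x) * (1 + 1 / n) := by
  have hn : (0 : ℝ) < n := by exact_mod_cast Nat.pos_of_ne_zero (NeZero.ne n)
  have comb : ∀ {d₁ d₂ d₃ d₄ d₅ S : ℝ},
      stepOp p w (expPot (1 / 2 ^ 57)) x ≤ (1 + d₁ / n) * expPot (1 / 2 ^ 57) x →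
      stepOp p w (expPot (-(1 / 2 ^ 57))) x ≤ (1 + d₂ / n) * expPot (-(1 / 2 ^ 57)) x →
      stepOp p w (expPot (1 / 2 ^ 16)) x ≤ (1 + d₃ / n) * expPot (1 / 2 ^ 16) x →
      stepOp p w (expPot (-(1 / 2 ^ 16))) x ≤ (1 + d₄ / n) * expPot (-(1 / 2 ^ 16)) x →
      huberPot 3 x + d₅ ≤ stepOp p w (huberPot 3) x →
      d₁ + d₂ + (1 / 2 ^ 80) * (d₃ + d₄) + (576 * (1 / 2 ^ 101) ^ 2 - 1 / 2 ^ 101 * d₅) ≤ 4 * S →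
      stepOp p w (fun x => Real.exp (logPot (1 / 2 ^ 57) (1 / 2 ^ 16) (1 / 2 ^ 80)
        (1 / 2 ^ 101) x)) x ≤ Real.exp (logPot (1 / 2 ^ 57) (1 / 2 ^ 16) (1 / 2 ^ 80)
        (1 / 2 ^ 101) x) * (1 + S / n) := by
    intro d₁ d₂ d₃ d₄ d₅ S H₁ H₂ H₃ H₄ H₅ hS
    refine (stepOp_exp_logPot_le h.toAdmissible (by norm_num) (by norm_num) (by norm_num)
      (by norm_num) x H₁ H₂ H₃ H₄ H₅).trans (mul_le_mul_of_nonneg_left ?_ (Real.exp_pos _).le)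
    have := div_le_div_of_nonneg_right hS hn.le
    have e : 4 * S / n = 4 * (S / n) := by ring
    linarith
  have P : ∀ a : ℝ, 0 ≤ a → a ≤ 1 / 4 →
      stepOp p w (expPot a) x ≤ (1 + 8 * a ^ 2 / n) * expPot a x := fun a h0 h4 => by
    simpa using h.stepOp_expPot_le h0 h4 x (R := 0) (by simpa using card_le_expPot a x)
  have N : ∀ a : ℝ, 0 ≤ a → a ≤ 1 / 4 →
      stepOp p w (expPot (-a)) x ≤ (1 + 8 * a ^ 2 / n) * expPot (-a) x := fun a h0 h4 => by
    simpa using h.stepOp_expPot_neg_le h0 h4 x (R := 0) (by simpa using card_le_expPot (-a) x)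
  have hα0 : (0 : ℝ) ≤ 1 / 2 ^ 57 := by norm_num
  have hα4 : (1 / 2 ^ 57 : ℝ) ≤ 1 / 4 := by norm_num
  have hγ0 : (0 : ℝ) ≤ 1 / 2 ^ 16 := by norm_num
  have hγ4 : (1 / 2 ^ 16 : ℝ) ≤ 1 / 4 := by norm_num
  have hδ0 := overFrac_nonneg x
  have hδ1 := overFrac_le_one x
  have Hgen := h.huberPot_drift hn2 x (K := 3) (η := 3) (by norm_num)
    (by linarith [overFrac_mul_le x])
  refine ⟨fun hbig => ?_, comb (P _ hα0 hα4) (N _ hα0 hα4) (P _ hγ0 hγ4) (N _ hγ0 hγ4) Hgen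
    (by norm_num)⟩
  rw [sub_eq_add_neg, ← neg_div]
  -- The threshold 2⁻³⁹ is γ²/128, as needed for `expPot_large_or_many_close`.
  by_cases hhigh : 1 - 1 / 2 ^ 39 ≤ overFrac x
  · have hη : 4 * (3 : ℝ) * (overFrac x * (1 - overFrac x)) ≤ 1 / 32 := by nlinarith
    rcases expPot_large_or_many_close (Finset.univ.filter fun i => 0 ≤ dev x i) (dev x)
      (γ := 1 / 2 ^ 16) (by norm_num) (by norm_num) (sum_dev x) (by simp)
      (fun i hi => le_of_lt (by simpa using hi))
      (by rw [← le_div_iff₀ hn]; exact le_trans (by norm_num) hhigh) with hlarge | ⟨G, hGO, hG, hG1⟩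
    -- A few far underloaded bins: the negative γ-potential gains about (3/4)ργ, of order 2⁻⁹⁶.
    · have hb := h.stepOp_expPot_neg_le hγ0 hγ4 x (R := 3 / 4)
        (by change _ ≤ _ * ∑ i, Real.exp (-(1 / 2 ^ 16) * dev x i); linarith)
      refine comb (P _ hα0 hα4) (N _ hα0 hα4) (P _ hγ0 hγ4) hb
        (h.huberPot_drift hn2 x (by norm_num) hη) ?_
      norm_num at hhigh ⊢
      linarith
    -- Half of the bins are close to the mean: the Huber potential grows by at least 1/16 - 1/32, a
    -- gain of τ/32 = 2⁻¹⁰⁶.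
    · refine comb (P _ hα0 hα4) (N _ hα0 hα4) (P _ hγ0 hγ4) (N _ hγ0 hγ4)
        (h.huberPot_drift_of_close hn2 x (b := 1 / 2) (by norm_num) hη G
          (fun j hj => (hG1 j hj).trans (by norm_num)) hG (by norm_num) fun j hj => ?_) (by norm_num)
      refine le_trans ?_ (h.le_mul_sq_over x j (by simpa using hGO hj))
      gcongr
      exact le_trans (by norm_num) hhigh
  by_cases hlow : overFrac x ≤ 1 / 2 ^ 39
  · have hη : 4 * (3 : ℝ) * (overFrac x * (1 - overFrac x)) ≤ 1 / 32 := by nlinarith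
    rcases expPot_large_or_many_close (Finset.univ.filter fun i => dev x i < 0)
      (fun i => -dev x i)
      (γ := 1 / 2 ^ 16) (by norm_num) (by norm_num)
      (by rw [Finset.sum_neg_distrib, sum_dev, neg_zero])
      (fun i hi => by have := (Finset.mem_filter.1 hi).2; linarith)
      (fun i hi => by simpa using hi)
      (by rw [← le_div_iff₀ hn, card_under_div]; norm_num at hlow ⊢; linarith)
      with hlarge | ⟨G, hGO, hG, hG1⟩
    · have hb := h.stepOp_expPot_le hγ0 hγ4 x (R := 3 / 4)
        (by simp only [neg_mul_neg] at hlarge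
            change _ ≤ _ * ∑ i, Real.exp ((1 / 2 ^ 16) * dev x i); linarith)
      refine comb (P _ hα0 hα4) (N _ hα0 hα4) hb (N _ hγ0 hγ4)
        (h.huberPot_drift hn2 x (by norm_num) hη) ?_
      norm_num at hlow ⊢
      linarith
    · refine comb (P _ hα0 hα4) (N _ hα0 hα4) (P _ hγ0 hγ4) (N _ hγ0 hγ4)
        (h.huberPot_drift_of_close hn2 x (b := 1 / 2) (by norm_num) hη G
          (fun j hj => by have := hG1 j hj; rw [abs_neg] at this; linarith) hG (by norm_num)
          fun j hj => ?_) (by norm_num)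
      refine le_trans ?_ (h.le_mul_sq_under x j (Finset.mem_filter.1 (hGO hj)).2)
      gcongr
      norm_num
  -- Balanced δ: the large α-potential itself gains at least α · 2⁻³⁹/2 = 2⁻⁹⁷, more than the
  -- general Huber loss 3τ.
  · rcases hbig with hbig | hbig
    · have hb := h.stepOp_expPot_le hα0 hα4 x (R := 1 / 2) (by linarith)
      refine comb hb (N _ hα0 hα4) (P _ hγ0 hγ4) (N _ hγ0 hγ4) Hgen ?_
      norm_num at hhigh ⊢
      linarith
    · have hb := h.stepOp_expPot_neg_le hα0 hα4 x (R := 1 / 2) (by linarith)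
      refine comb (P _ hα0 hα4) hb (P _ hγ0 hγ4) (N _ hγ0 hγ4) Hgen ?_
      norm_num at hlow ⊢
      linarith

end MeanBiased

theorem sum_ite_neg_dev {n : ℕ} [NeZero n] (x : Load n) (a b : ℝ) :
    ∑ i, (if dev x i < 0 then a else b) = n * ((1 - overFrac x) * a + overFrac x * b) := by
  have hn : (n : ℝ) ≠ 0 := by exact_mod_cast NeZero.ne n
  rw [Finset.sum_ite, Finset.sum_const, Finset.sum_const, nsmul_eq_mul, nsmul_eq_mul,
    ← card_under_div, overFrac]
  simp only [not_lt]
  field_simp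

theorem meanBiased_thinning (n : ℕ) [NeZero n] :
    MeanBiased (n := n) thinningProb (fun _ _ => 1) := by
  have hn : (0 : ℝ) < n := by exact_mod_cast Nat.pos_of_ne_zero (NeZero.ne n)
  have hsum : ∀ x : Load n, ∑ i, thinningProb x i = 1 := by
    intro x
    simp only [thinningProb, ← Finset.sum_div, Finset.sum_add_distrib, Finset.sum_const,
      Finset.card_univ, Fintype.card_fin, nsmul_eq_mul]
    have := sum_ite_neg_dev x 1 0
    rw [show ∑ i, (if dev x i < 0 then (1 : ℝ) else 0) = n * (1 - overFrac x) by
      rw [this]; ring]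
    field_simp
    ring
  constructor
  · constructor
    · intro x i
      have := overFrac_nonneg x
      unfold thinningProb
      split_ifs <;> positivity
    · exact hsum
    · exact fun _ _ => le_rfl
    · exact fun _ _ => one_le_two
    · intro x i
      have := overFrac_le_one x
      rw [Nat.cast_one, one_pow, mul_one, thinningProb]
      gcongr
      split_ifs <;> linarith
  all_goals intro x i hi
  · simp only [drift, Nat.cast_one, mul_one, hsum]
    rw [thinningProb, if_pos hi]; ring
  · simp only [drift, Nat.cast_one, mul_one, hsum]
    rw [thinningProb, if_neg (not_lt.2 hi)]; ring
  · have := overFrac_nonneg x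
    rw [thinningProb, if_pos hi, Nat.cast_one, one_pow, mul_one]
    gcongr
    linarith
  · rw [thinningProb, if_neg (not_lt.2 hi), Nat.cast_one, one_pow, mul_one, zero_add]

theorem meanBiased_twinning (n : ℕ) [NeZero n] :
    MeanBiased (n := n) (fun _ _ => (n : ℝ)⁻¹) twinningBalls := by
  have hn : (0 : ℝ) < n := by exact_mod_cast Nat.pos_of_ne_zero (NeZero.ne n)
  have hsum : ∀ x : Load n, ∑ i, (n : ℝ)⁻¹ * (twinningBalls x i : ℝ) = 2 - overFrac x := by
    intro x
    rw [← Finset.mul_sum]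
    simp only [twinningBalls, Nat.cast_ite, Nat.cast_ofNat, Nat.cast_one]
    rw [sum_ite_neg_dev]
    field_simp
    ring
  constructor
  · constructor
    · intro x i; positivity
    · intro x; simp
    · intro x i; unfold twinningBalls; split_ifs <;> norm_num
    · intro x i; unfold twinningBalls; split_ifs <;> norm_num
    · intro x i
      rw [inv_mul_eq_div]
      gcongr
      unfold twinningBalls; split_ifs <;> norm_num
  all_goals intro x i hi
  · rw [drift, hsum, twinningBalls, if_pos hi]; push_cast; ring
  · rw [drift, hsum, twinningBalls, if_neg (not_lt.2 hi)]; push_cast; ring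
  · rw [twinningBalls, if_pos hi, inv_mul_eq_div]
    gcongr
    norm_num
  · rw [twinningBalls, if_neg (not_lt.2 hi), inv_mul_eq_div]
    gcongr
    simpa using overFrac_le_one x

/-! ### The `(1+β)`-process -/

section Mixed

variable {n : ℕ}

theorem twoChoiceProb_nonneg (x : Load n) (i : Fin n) : 0 ≤ twoChoiceProb x i := by
  unfold twoChoiceProb; positivity

theorem twoChoiceProb_le [NeZero n] (x : Load n) (i : Fin n) : twoChoiceProb x i ≤ 2 / n := by
  classical
  have hn : (0 : ℝ) < n := by exact_mod_cast Nat.pos_of_ne_zero (NeZero.ne n)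
  have hsub : (Finset.univ.filter fun q : Fin n × Fin n => lighter x q.1 q.2 = i) ⊆
      ({i} ×ˢ Finset.univ) ∪ (Finset.univ ×ˢ {i}) := by
    intro q hq
    simp only [Finset.mem_filter, Finset.mem_univ, true_and] at hq
    simp only [Finset.mem_union, Finset.mem_product, Finset.mem_singleton, Finset.mem_univ,
      and_true, true_and]
    rw [← hq]
    unfold lighter
    split_ifs
    · exact Or.inl rfl
    · exact Or.inr rfl
    · rcases max_choice q.1 q.2 with h | h <;> rw [h] <;> simp
  have hc := (Finset.card_le_card hsub).trans (Finset.card_union_le _ _)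
  simp only [Finset.card_product, Finset.card_singleton, Finset.card_univ, Fintype.card_fin,
    one_mul, mul_one] at hc
  have hc' : ((Finset.univ.filter fun q : Fin n × Fin n => lighter x q.1 q.2 = i).card : ℝ) ≤
      2 * n := by exact_mod_cast hc.trans (by omega)
  rw [twoChoiceProb, div_le_div_iff₀ (by positivity) hn]
  nlinarith

theorem sum_twoChoiceProb [NeZero n] (x : Load n) : ∑ i, twoChoiceProb x i = 1 := by
  have hn : (n : ℝ) ≠ 0 := by exact_mod_cast NeZero.ne n
  have := sum_twoChoiceProb_mul x (fun _ => 1)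
  simp only [mul_one, Finset.sum_const, Finset.card_univ, Fintype.card_fin, nsmul_eq_mul] at this
  rw [this]
  field_simp

theorem sum_mixedProb [NeZero n] (β : ℝ≥0) (x : Load n) : ∑ i, mixedProb β x i = 1 := by
  have hn : (n : ℝ) ≠ 0 := by exact_mod_cast NeZero.ne n
  simp only [mixedProb, Finset.sum_add_distrib, ← Finset.mul_sum, sum_twoChoiceProb,
    Finset.sum_const, Finset.card_univ, Fintype.card_fin, nsmul_eq_mul]
  field_simp
  ring

theorem admissible_mixed [NeZero n] {β : ℝ≥0} (hβ : β ≤ 1) :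
    Admissible (n := n) (mixedProb β) (fun _ _ => 1) := by
  have hβ' : (β : ℝ) ≤ 1 := by exact_mod_cast hβ
  have hβ0 : (0 : ℝ) ≤ β := β.2
  have hn : (0 : ℝ) < n := by exact_mod_cast Nat.pos_of_ne_zero (NeZero.ne n)
  have h1β : 0 ≤ 1 - (β : ℝ) := by linarith
  constructor
  · intro x i
    have := twoChoiceProb_nonneg x i
    unfold mixedProb
    positivity
  · exact sum_mixedProb β
  · exact fun _ _ => le_rfl
  · exact fun _ _ => one_le_two
  · intro x i
    have h2 := twoChoiceProb_le x i
    rw [Nat.cast_one, one_pow, mul_one, mixedProb]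
    have h3 := mul_le_mul_of_nonneg_left h2 hβ0
    have e : 4 / (n : ℝ) = 4 * (1 / n) := by ring
    have e' : (2 : ℝ) / n = 2 * (1 / n) := by ring
    have e'' : (1 - (β : ℝ)) / n = (1 - β) * (1 / n) := by ring
    have h4 : 0 < 1 / (n : ℝ) := by positivity
    rw [e] ; rw [e'] at h3; rw [e'']
    nlinarith

/-- The function a · exp(a · dev) is increasing in the load for either sign of a, so the lighter bin
attains the minimum of two values, which is their mean minus half their distance. Both signs of the
exponent are thereby treated at once. -/
theorem exp_lighter (x : Load n) (a : ℝ) (i j : Fin n) :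
    a * Real.exp (a * dev x (lighter x i j)) =
      a * ((Real.exp (a * dev x i) + Real.exp (a * dev x j)) / 2) -
        |a| * |Real.exp (a * dev x i) - Real.exp (a * dev x j)| / 2 := by
  have key : ∀ k l : Fin n, x k ≤ x l → a * Real.exp (a * dev x k) =
      a * ((Real.exp (a * dev x k) + Real.exp (a * dev x l)) / 2) -
        |a| * |Real.exp (a * dev x k) - Real.exp (a * dev x l)| / 2 := by
    intro k l hkl
    have hd : dev x k ≤ dev x l := by
      unfold dev
      have : (x k : ℝ) ≤ x l := by exact_mod_cast hkl
      linarith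
    rcases le_total 0 a with ha | ha
    · have : Real.exp (a * dev x k) ≤ Real.exp (a * dev x l) :=
        Real.exp_le_exp.2 (mul_le_mul_of_nonneg_left hd ha)
      rw [abs_of_nonneg ha, abs_of_nonpos (by linarith)]
      ring
    · have : Real.exp (a * dev x l) ≤ Real.exp (a * dev x k) :=
        Real.exp_le_exp.2 (mul_le_mul_of_nonpos_left hd ha)
      rw [abs_of_nonpos ha, abs_of_nonneg (by linarith)]
      ring
  have key' : x j ≤ x i → a * Real.exp (a * dev x j) =
      a * ((Real.exp (a * dev x i) + Real.exp (a * dev x j)) / 2) -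
        |a| * |Real.exp (a * dev x i) - Real.exp (a * dev x j)| / 2 := by
    intro hji
    rw [abs_sub_comm, add_comm (Real.exp (a * dev x i))]
    exact key j i hji
  unfold lighter
  split_ifs with h1 h2
  · exact key i j h1.le
  · exact key' h2.le
  · rcases max_choice i j with h | h <;> rw [h]
    · exact key i j (not_lt.1 h2)
    · exact key' (not_lt.1 h1)

/-- The average part of `exp_lighter` is what uniform allocation would give and cancels against the
shift of the mean; only the pairwise distances remain. -/
theorem sum_drift_mixed [NeZero n] (β : ℝ≥0) (a : ℝ) (x : Load n) :
    a * ∑ i, drift (mixedProb β) (fun _ _ => 1) x i * Real.exp (a * dev x i) =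
      -(β * |a| / (2 * n ^ 2)) *
        ∑ i, ∑ j, |Real.exp (a * dev x i) - Real.exp (a * dev x j)| := by
  have hn : (n : ℝ) ≠ 0 := by exact_mod_cast NeZero.ne n
  have h1 : ∀ i, drift (mixedProb β) (fun _ _ => 1) x i =
      β * twoChoiceProb x i - β / n := by
    intro i
    simp only [drift, Nat.cast_one, mul_one, sum_mixedProb]
    rw [mixedProb]
    ring
  have h2 : a * ∑ i, twoChoiceProb x i * Real.exp (a * dev x i) =
      (a * (n * expPot a x) -
        |a| / 2 * ∑ i, ∑ j, |Real.exp (a * dev x i) - Real.exp (a * dev x j)|) / n ^ 2 := by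
    rw [sum_twoChoiceProb_mul, ← mul_div_assoc]
    congr 1
    simp only [Finset.mul_sum, exp_lighter, Finset.sum_sub_distrib]
    congr 1
    · simp only [← Finset.mul_sum, ← Finset.sum_div, Finset.sum_add_distrib, Finset.sum_const,
        Finset.card_univ, Fintype.card_fin, nsmul_eq_mul]
      rw [expPot]
      ring
    · exact Finset.sum_congr rfl fun i _ => Finset.sum_congr rfl fun j _ => by ring
  calc a * ∑ i, drift (mixedProb β) (fun _ _ => 1) x i * Real.exp (a * dev x i)
      = β * (a * ∑ i, twoChoiceProb x i * Real.exp (a * dev x i)) - a * β / n * expPot a x := by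
        simp only [h1, sub_mul, Finset.sum_sub_distrib, expPot, Finset.mul_sum, mul_sub]
        congr 1 <;> exact Finset.sum_congr rfl fun i _ => by ring
    _ = _ := by
        rw [h2]
        field_simp
        ring

theorem sum_abs_sub_mean_le [NeZero n] (z : Fin n → ℝ) :
    ∑ i, |z i - (∑ j, z j) / n| ≤ (∑ i, ∑ j, |z i - z j|) / n := by
  have hn : (0 : ℝ) < n := by exact_mod_cast Nat.pos_of_ne_zero (NeZero.ne n)
  rw [Finset.sum_div (f := fun i => ∑ j, |z i - z j|)]
  refine Finset.sum_le_sum fun i _ => ?_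
  have : z i - (∑ j, z j) / n = (∑ j, (z i - z j)) / n := by
    rw [Finset.sum_sub_distrib, Finset.sum_const, Finset.card_univ, Fintype.card_fin, nsmul_eq_mul]
    field_simp
  rw [this, abs_div, abs_of_pos hn]
  exact div_le_div_of_nonneg_right (Finset.abs_sum_le_sum_abs (fun j => z i - z j) _) hn.le

/-- If the positive numbers `exp (v i)` with `∑ v = 0` have large mean, then these numbers or their
inverses are spread out. -/
theorem spread_or_spread_neg [NeZero n] (v : Fin n → ℝ) (hv : ∑ i, v i = 0)
    (hbig : 2 * (n : ℝ) ≤ ∑ i, Real.exp (v i)) :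
    1 / 10000 * n * ∑ i, Real.exp (v i) ≤ ∑ i, ∑ j, |Real.exp (v i) - Real.exp (v j)| ∨
    1 / 10000 * n * ∑ i, Real.exp (-v i) ≤
      ∑ i, ∑ j, |Real.exp (-v i) - Real.exp (-v j)| := by
  classical
  have hn : (0 : ℝ) < n := by exact_mod_cast Nat.pos_of_ne_zero (NeZero.ne n)
  by_contra hcon
  push Not at hcon
  obtain ⟨hc1, hc2⟩ := hcon
  set μ := (∑ j, Real.exp (v j)) / n with hμ
  set ν := (∑ j, Real.exp (-v j)) / n with hν
  have hμ2 : 2 ≤ μ := by rw [hμ, le_div_iff₀ hn]; exact hbig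
  have d1 : ∑ i, |Real.exp (v i) - μ| ≤ 1 / 10000 * (n * μ) := by
    refine (sum_abs_sub_mean_le fun i => Real.exp (v i)).trans ?_
    rw [div_le_iff₀ hn, hμ]
    refine hc1.le.trans (le_of_eq ?_)
    field_simp
  have d2 : ∑ i, |Real.exp (-v i) - ν| < 1 / 10000 * (n * ν) := by
    refine (sum_abs_sub_mean_le fun i => Real.exp (-v i)).trans_lt ?_
    rw [div_lt_iff₀ hn, hν]
    refine hc2.trans_le (le_of_eq ?_)
    field_simp
  -- If exp(v) is concentrated around its mean μ ≥ 2, few indices have v ≤ 1/3, since there exp(v) ≤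
  -- 3/2 ≤ 3μ/4.
  set S := Finset.univ.filter fun i => v i ≤ 1 / 3 with hS
  have hexp : Real.exp (1 / 3) ≤ 3 / 2 := by
    have := exp_le_quadratic (u := 1 / 3) (by rw [abs_of_pos] <;> norm_num)
    norm_num at this ⊢; linarith
  have hScard : (S.card : ℝ) ≤ n / 2500 := by
    have h1 : ∀ i ∈ S, μ / 4 ≤ |Real.exp (v i) - μ| := by
      intro i hi
      have := (Real.exp_le_exp.2 (Finset.mem_filter.1 hi).2).trans hexp
      rw [abs_sub_comm]
      exact le_trans (by linarith) (le_abs_self _)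
    have h2 := (Finset.card_nsmul_le_sum S _ _ h1).trans
      ((Finset.sum_le_sum_of_subset_of_nonneg (Finset.subset_univ S)
        fun i _ _ => abs_nonneg _).trans d1)
    rw [nsmul_eq_mul] at h2
    have h3 : (S.card : ℝ) * μ ≤ n / 2500 * μ := by linarith
    exact le_of_mul_le_mul_right h3 (by linarith)
  have hSc : (Sᶜ.card : ℝ) = n - S.card := by
    rw [Finset.card_compl, Fintype.card_fin, Nat.cast_sub (by simpa using Finset.card_le_univ S)]
  have hSsum : (n : ℝ) / 4 ≤ ∑ i ∈ S, -v i := by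
    have h1 : ∀ i ∈ Sᶜ, 1 / 3 ≤ v i := by
      intro i hi
      simp only [hS, Finset.mem_compl, Finset.mem_filter, Finset.mem_univ, true_and, not_le] at hi
      exact hi.le
    have h2 := Finset.card_nsmul_le_sum Sᶜ _ _ h1
    rw [nsmul_eq_mul, hSc] at h2
    have h3 := Finset.sum_add_sum_compl S v
    rw [Finset.sum_neg_distrib]
    linarith
  -- The few indices in `S` must compensate the positive sum elsewhere. The tangent of exp at 4 then
  -- makes the mean ν of exp(-v) at least 4, although exp(-v) ≤ 1 off `S`: so exp(-v) is far from
  -- concentrated.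
  have hν4 : 4 ≤ ν := by
    have h1 : ∀ i ∈ S, Real.exp 4 * (-v i - 3) ≤ Real.exp (-v i) := by
      intro i _
      have := Real.add_one_le_exp (-v i - 4)
      have h2 := mul_le_mul_of_nonneg_left this (Real.exp_pos 4).le
      rw [← Real.exp_add] at h2
      refine le_trans (le_of_eq ?_) (h2.trans (le_of_eq ?_)) <;> ring_nf
    have h2 := (Finset.sum_le_sum h1).trans (Finset.sum_le_sum_of_subset_of_nonneg
      (Finset.subset_univ S) fun i _ _ => (Real.exp_pos (-v i)).le)
    rw [← Finset.mul_sum, Finset.sum_sub_distrib, Finset.sum_const, nsmul_eq_mul] at h2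
    have h4 : 20 ≤ Real.exp 4 := by
      have e1 : (2.7 : ℝ) ≤ Real.exp 1 := by have := Real.exp_one_gt_d9; linarith
      have e2 : Real.exp 4 = Real.exp 1 ^ 4 := by rw [← Real.exp_nat_mul]; norm_num
      rw [e2]
      exact le_trans (by norm_num) (pow_le_pow_left₀ (by norm_num) e1 4)
    have h5 : (n : ℝ) / 5 ≤ ∑ i ∈ S, -v i - S.card * 3 := by linarith
    rw [hν, le_div_iff₀ hn]
    nlinarith
  have hfin : n * (ν / 2) / 2 ≤ ∑ i, |Real.exp (-v i) - ν| := by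
    have h1 : ∀ i ∈ Sᶜ, ν / 2 ≤ |Real.exp (-v i) - ν| := by
      intro i hi
      simp only [hS, Finset.mem_compl, Finset.mem_filter, Finset.mem_univ, true_and, not_le] at hi
      have : Real.exp (-v i) ≤ 1 := Real.exp_le_one_iff.2 (by linarith)
      rw [abs_sub_comm]
      exact le_trans (by linarith) (le_abs_self _)
    have h2 := (Finset.card_nsmul_le_sum Sᶜ _ _ h1).trans
      (Finset.sum_le_sum_of_subset_of_nonneg (Finset.subset_univ Sᶜ)
        fun i _ _ => abs_nonneg _)
    rw [nsmul_eq_mul, hSc] at h2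
    have h3 : (n : ℝ) / 2 * (ν / 2) ≤ (n - S.card) * (ν / 2) :=
      mul_le_mul_of_nonneg_right (by linarith) (by linarith)
    linarith
  nlinarith [mul_pos hn (by linarith : 0 < ν)]

/-- The exponent used for the `(1+β)`-process. -/
def mixedExp (β : ℝ≥0) : ℝ := β / 10 ^ 6

/-- The spread lemma suffices here, so the γ- and Huber components are switched off. With β = 10⁶α
the spread potential gains βα/20000 = 50α², against second-order errors 16α²; the net drop exceeds
the required 4α². -/
theorem mixed_logPot_drift [NeZero n] {β : ℝ≥0} (hβ0 : 0 < β) (hβ : β ≤ 1) (x : Load n) :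
    (2 * n ≤ expPot (mixedExp β) x ∨ 2 * n ≤ expPot (-mixedExp β) x →
      stepOp (mixedProb β) (fun _ _ => 1) (fun x => Real.exp (logPot (mixedExp β) 0 0 0 x)) x ≤
        Real.exp (logPot (mixedExp β) 0 0 0 x) * (1 - mixedExp β ^ 2 / n)) ∧
    stepOp (mixedProb β) (fun _ _ => 1) (fun x => Real.exp (logPot (mixedExp β) 0 0 0 x)) x ≤
      Real.exp (logPot (mixedExp β) 0 0 0 x) * (1 + 1 / n) := by
  have hn : (0 : ℝ) < n := by exact_mod_cast Nat.pos_of_ne_zero (NeZero.ne n)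
  have hA := admissible_mixed (n := n) hβ
  have hβ' : (β : ℝ) ≤ 1 := by exact_mod_cast hβ
  have hβp : (0 : ℝ) < β := by exact_mod_cast hβ0
  set α := mixedExp β with hα
  have hβα : (β : ℝ) = 10 ^ 6 * α := by rw [hα, mixedExp]; ring
  have hα0 : 0 < α := by linarith
  have hα1 : α ≤ 1 / 10 ^ 6 := by linarith
  have grow : ∀ a : ℝ, |a| = α → ∀ f : ℝ, f * n * expPot a x ≤
      ∑ i, ∑ j, |Real.exp (a * dev x i) - Real.exp (a * dev x j)| →
      stepOp (mixedProb β) (fun _ _ => 1) (expPot a) x ≤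
        (1 + (8 * α ^ 2 - β * α * f / 2) / n) * expPot a x := by
    intro a ha f hf
    have h1 := stepOp_expPot_le hA (a := a) (by rw [ha]; linarith) x
    rw [sum_drift_mixed, ← sq_abs, ha] at h1
    have h2 := mul_le_mul_of_nonneg_left hf (by positivity : 0 ≤ β * α / (2 * (n : ℝ) ^ 2))
    calc _ ≤ _ := h1
      _ ≤ (1 + 8 * α ^ 2 / n) * expPot a x -
          β * α / (2 * (n : ℝ) ^ 2) * (f * n * expPot a x) := by linarith
      _ = _ := by field_simp; ring
  have ha1 : |α| = α := abs_of_pos hα0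
  have ha2 : |-α| = α := by rw [abs_neg, ha1]
  have g0 : ∀ a : ℝ, |a| = α → stepOp (mixedProb β) (fun _ _ => 1) (expPot a) x ≤
        (1 + (8 * α ^ 2) / n) * expPot a x := by
    intro a ha
    have := grow a ha 0 (by
      rw [zero_mul, zero_mul]
      exact Finset.sum_nonneg fun i _ => Finset.sum_nonneg fun j _ => abs_nonneg _)
    simpa using this
  have gz : stepOp (mixedProb β) (fun _ _ => 1) (expPot 0) x ≤
        (1 + 0 / n) * expPot 0 x := by
    have := stepOp_expPot_le hA (a := 0) (by norm_num) x
    simpa using this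
  have gz' : stepOp (mixedProb β) (fun _ _ => 1) (expPot (-0)) x ≤
        (1 + 0 / n) * expPot (-0) x := by rw [neg_zero]; exact gz
  have comb : ∀ {d₁ d₂ S : ℝ},
      stepOp (mixedProb β) (fun _ _ => 1) (expPot α) x ≤ (1 + d₁ / n) * expPot α x →
      stepOp (mixedProb β) (fun _ _ => 1) (expPot (-α)) x ≤ (1 + d₂ / n) * expPot (-α) x →
      d₁ + d₂ ≤ 4 * S →
      stepOp (mixedProb β) (fun _ _ => 1) (fun x => Real.exp (logPot α 0 0 0 x)) x ≤
        Real.exp (logPot α 0 0 0 x) * (1 + S / n) := by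
    intro d₁ d₂ S H₁ H₂ hS
    have := stepOp_exp_logPot_le hA (ρ := 0) (τ := 0) le_rfl (by norm_num) le_rfl
      (by norm_num) x (d₅ := stepOp (mixedProb β) (fun _ _ => 1) (huberPot 3) x - huberPot 3 x)
      H₁ H₂ gz gz' (by linarith)
    refine this.trans (mul_le_mul_of_nonneg_left ?_ (Real.exp_pos _).le)
    have h4 := div_le_div_of_nonneg_right hS hn.le
    have e : 4 * S / n = 4 * (S / n) := by ring
    simp only [zero_mul, add_zero, ne_eq, OfNat.ofNat_ne_zero, not_false_eq_true, zero_pow,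
      mul_zero, sub_zero]
    linarith
  have hspread : 2 * n ≤ expPot α x ∨ 2 * n ≤ expPot (-α) x →
      1 / 10000 * n * expPot α x ≤
        ∑ i, ∑ j, |Real.exp (α * dev x i) - Real.exp (α * dev x j)| ∨
      1 / 10000 * n * expPot (-α) x ≤
        ∑ i, ∑ j, |Real.exp (-α * dev x i) - Real.exp (-α * dev x j)| := by
    rintro (hb | hb)
    · have := spread_or_spread_neg (fun i => α * dev x i)
        (by rw [← Finset.mul_sum, sum_dev, mul_zero]) hb
      simpa only [expPot, neg_mul] using this
    · have := spread_or_spread_neg (fun i => -α * dev x i)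
        (by rw [← Finset.mul_sum, sum_dev, mul_zero]) hb
      simpa only [expPot, neg_mul, neg_neg] using this.symm
  refine ⟨fun hbig => ?_, comb (g0 _ ha1) (g0 _ ha2) (by nlinarith)⟩
  rw [sub_eq_add_neg, ← neg_div]
  rcases hspread hbig with hs | hs
  · exact comb (grow _ ha1 _ hs) (g0 _ ha2) (by rw [hβα]; nlinarith)
  · exact comb (g0 _ ha1) (grow _ ha2 _ hs) (by rw [hβα]; nlinarith)

end Mixed

/-! ### The upper bounds -/

theorem upper_bound_of_iterate_le {Q : AllocProcess} {K : ℝ} (hK : 0 < K)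
    {p : ∀ (n : ℕ) [NeZero n], Load n → Fin n → ℝ}
    {w : ∀ (n : ℕ) [NeZero n], Load n → Fin n → ℕ}
    (hQ : ∀ (n : ℕ) [NeZero n], Represents Q n (p n) (w n))
    (h : ∀ (n : ℕ) [NeZero n], Admissible (p n) (w n))
    (hle : ∀ (n : ℕ) [NeZero n], 2 ≤ n → ∀ m, gapProb Q n m (fun g => K * Real.log n < g) ≤
      ((n : ℝ) ^ 4)⁻¹) :
    ∃ K : ℝ, 0 < K ∧ ∃ N : ℕ, ∀ (n : ℕ) [NeZero n], N ≤ n → ∀ m : ℕ,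
      1 - ((n : ℝ) ^ 4)⁻¹ ≤ gapProb Q n m (fun g => g ≤ K * Real.log n) :=
  ⟨K, hK, 2, fun n _ hn m => one_sub_le_gapProb (hQ n) (h n) m _ _ (fun _ => not_lt.symm)
    (hle n hn m)⟩

theorem gapConst_pos {α γ ρ c D : ℝ} (hα : 0 < α) (hγ : 0 ≤ γ) (hρ : 0 ≤ ρ) (hc : 0 < c)
    (hD : 0 ≤ D) : 0 < gapConst α γ ρ c D := by
  have hF1 : 0 ≤ Real.log (1 + (D + c) / c) := Real.log_nonneg (by
    have : 0 ≤ (D + c) / c := by positivity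
    linarith)
  unfold gapConst
  positivity

theorem upper_bound_of_meanBiased {Q : AllocProcess}
    {p : ∀ (n : ℕ) [NeZero n], Load n → Fin n → ℝ}
    {w : ∀ (n : ℕ) [NeZero n], Load n → Fin n → ℕ}
    (hQ : ∀ (n : ℕ) [NeZero n], Represents Q n (p n) (w n))
    (h : ∀ (n : ℕ) [NeZero n], MeanBiased (p n) (w n)) :
    ∃ K : ℝ, 0 < K ∧ ∃ N : ℕ, ∀ (n : ℕ) [NeZero n], N ≤ n → ∀ m : ℕ,
      1 - ((n : ℝ) ^ 4)⁻¹ ≤ gapProb Q n m (fun g => g ≤ K * Real.log n) := by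
  refine upper_bound_of_iterate_le
    (K := gapConst (1 / 2 ^ 57) (1 / 2 ^ 16) (1 / 2 ^ 80) (1 / 2 ^ 111) 1)
    (gapConst_pos (by norm_num) (by norm_num) (by norm_num) (by norm_num) (by norm_num)) hQ
    (fun n _ => (h n).toAdmissible) fun n _ hn m => ?_
  rw [gapProb_eq (hQ n) (h n).nonneg]
  exact stepOp_iterate_gap_le hn (h n).toAdmissible (τ := 1 / 2 ^ 101) (by norm_num) (by norm_num)
    (by norm_num) (by norm_num) (by norm_num) (by norm_num) (by norm_num) (by norm_num)
    (fun x => ((h n).logPot_drift hn x).1) (fun x => ((h n).logPot_drift hn x).2) m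

theorem upper_bound_onePlusBeta {β : ℝ≥0} (hβ0 : 0 < β) (hβ : β ≤ 1) :
    ∃ K : ℝ, 0 < K ∧ ∃ N : ℕ, ∀ (n : ℕ) [NeZero n], N ≤ n → ∀ m : ℕ,
      1 - ((n : ℝ) ^ 4)⁻¹ ≤ gapProb (onePlusBeta β hβ) n m (fun g => g ≤ K * Real.log n) := by
  have hβ' : (β : ℝ) ≤ 1 := by exact_mod_cast hβ
  have hβp : (0 : ℝ) < β := by exact_mod_cast hβ0
  have hα : 0 < mixedExp β := by unfold mixedExp; positivity
  have hα1 : mixedExp β ≤ 1 := by unfold mixedExp; linarith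
  refine upper_bound_of_iterate_le (K := gapConst (mixedExp β) 0 0 (mixedExp β ^ 2) 1)
    (gapConst_pos hα le_rfl le_rfl (by positivity) (by norm_num))
    (fun n _ => represents_onePlusBeta β hβ n)
    (fun n _ => admissible_mixed hβ) fun n _ hn m => ?_
  rw [gapProb_eq (represents_onePlusBeta β hβ n) (admissible_mixed hβ).nonneg]
  exact stepOp_iterate_gap_le hn (admissible_mixed hβ) (τ := 0) hα le_rfl
    le_rfl le_rfl (by linarith) (by positivity) (pow_le_one₀ hα.le hα1) (by norm_num)
    (fun x => (mixed_logPot_drift hβ0 hβ x).1) (fun x => (mixed_logPot_drift hβ0 hβ x).2) m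

/-! ### Hitting a high load -/

/-- The probability that `r` trials with success probability `q` have at least `M - k`
successes. -/
def hitProb (q : ℝ) (M : ℕ) : ℕ → ℕ → ℝ
  | 0, k => if M ≤ k then 1 else 0
  | r + 1, k => (1 - q) * hitProb q M r k + q * hitProb q M r (k + 1)

section HitProb

variable {q : ℝ} {M : ℕ}

theorem hitProb_le_one (h0 : 0 ≤ q) (h1 : q ≤ 1) (r k : ℕ) : hitProb q M r k ≤ 1 := by
  induction r generalizing k with
  | zero => unfold hitProb; split_ifs <;> norm_num
  | succ r ih =>
    have := mul_le_mul_of_nonneg_left (ih k) (by linarith : 0 ≤ 1 - q)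
    have := mul_le_mul_of_nonneg_left (ih (k + 1)) h0
    unfold hitProb
    linarith

theorem hitProb_mono (h0 : 0 ≤ q) (h1 : q ≤ 1) (r : ℕ) : Monotone (hitProb q M r) := by
  induction r with
  | zero =>
    intro k l hkl
    unfold hitProb
    split_ifs <;> first | omega | norm_num
  | succ r ih =>
    intro k l hkl
    have := mul_le_mul_of_nonneg_left (ih hkl) (by linarith : 0 ≤ 1 - q)
    have := mul_le_mul_of_nonneg_left (ih (Nat.succ_le_succ hkl)) h0
    simp only [hitProb]
    linarith

/-- A single binomial term, with the exponent of 1 - q enlarged to r; the induction is Pascal's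
rule. -/
theorem choose_mul_le_hitProb (h0 : 0 ≤ q) (h1 : q ≤ 1) (r k j : ℕ) (hkj : k + j = M) :
    (r.choose j : ℝ) * q ^ j * (1 - q) ^ r ≤ hitProb q M r k := by
  have h1q : 0 ≤ 1 - q := by linarith
  have h1q' : 1 - q ≤ 1 := by linarith
  induction r generalizing k j with
  | zero =>
    cases j with
    | zero => unfold hitProb; rw [if_pos (by omega)]; simp
    | succ j => unfold hitProb; rw [if_neg (by omega)]; simp
  | succ r ih =>
    have i1 := mul_le_mul_of_nonneg_left (ih k j hkj) h1q
    cases j with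
    | zero =>
      have hm := hitProb_mono (M := M) h0 h1 r (Nat.le_succ k)
      have i2 := mul_le_mul_of_nonneg_left (hm) h0
      have i3 := ih k 0 hkj
      unfold hitProb
      simp only [Nat.choose_zero_right, Nat.cast_one, pow_zero, one_mul, mul_one] at i1 i3 ⊢
      have i4 : (1 - q) ^ (r + 1) ≤ (1 - q) ^ r := pow_le_pow_of_le_one h1q h1q' (Nat.le_succ r)
      simp only [Nat.succ_eq_add_one] at i2
      linarith
    | succ j =>
      have i2 := mul_le_mul_of_nonneg_left (ih (k + 1) j (by omega)) h0
      unfold hitProb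
      rw [Nat.choose_succ_succ, Nat.cast_add]
      have i4 : (r.choose j : ℝ) * q ^ (j + 1) * (1 - q) ^ (r + 1) ≤
          (r.choose j : ℝ) * q ^ (j + 1) * (1 - q) ^ r := by
        gcongr 1
        exact pow_le_pow_of_le_one h1q h1q' (Nat.le_succ r)
      calc _ = (1 - q) * ((r.choose (j + 1) : ℝ) * q ^ (j + 1) * (1 - q) ^ r) +
            (r.choose j : ℝ) * q ^ (j + 1) * (1 - q) ^ (r + 1) := by ring
        _ ≤ (1 - q) * ((r.choose (j + 1) : ℝ) * q ^ (j + 1) * (1 - q) ^ r) +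
            q * ((r.choose j : ℝ) * q ^ j * (1 - q) ^ r) := by
          refine add_le_add_right (i4.trans (le_of_eq ?_)) _
          ring
        _ ≤ _ := add_le_add i1 i2

end HitProb

/-- A comparison of exclusive with independent increments: on the left at most one factor decreases,
each with probability q; on the right every factor decreases independently. The terms of second
order in q have the favourable sign. -/
theorem prod_sub_sum_le_prod_sub {ι : Type*} [DecidableEq ι] (s : Finset ι) (a e : ι → ℝ) {q : ℝ}
    (h0 : 0 ≤ q) (h1 : q ≤ 1) (he : ∀ i, 0 ≤ e i) (hea : ∀ i, e i ≤ a i) :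
    ∏ i ∈ s, a i - q * ∑ i ∈ s, e i * ∏ j ∈ s.erase i, a j ≤ ∏ i ∈ s, (a i - q * e i) := by
  have ha : ∀ i, 0 ≤ a i := fun i => (he i).trans (hea i)
  induction s using Finset.induction_on with
  | empty => simp
  | insert k s hk ih =>
    have hD : ∑ i ∈ insert k s, e i * ∏ j ∈ (insert k s).erase i, a j =
        e k * ∏ j ∈ s, a j + a k * ∑ i ∈ s, e i * ∏ j ∈ s.erase i, a j := by
      rw [Finset.sum_insert hk, Finset.erase_insert hk, Finset.mul_sum]
      congr 1
      refine Finset.sum_congr rfl fun i hi => ?_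
      have hik : k ≠ i := fun h => hk (h ▸ hi)
      rw [Finset.erase_insert_of_ne hik, Finset.prod_insert fun h => hk (Finset.mem_of_mem_erase h)]
      ring
    rw [hD, Finset.prod_insert hk, Finset.prod_insert hk]
    have hqe : 0 ≤ a k - q * e k := by nlinarith [he k, hea k]
    have i1 := mul_le_mul_of_nonneg_left ih hqe
    have i2 : 0 ≤ q * e k * (q * ∑ i ∈ s, e i * ∏ j ∈ s.erase i, a j) :=
      mul_nonneg (mul_nonneg h0 (he k)) (mul_nonneg h0 (Finset.sum_nonneg fun i _ =>
        mul_nonneg (he i) (Finset.prod_nonneg fun j _ => ha j)))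
    linarith

section Hitting

variable {n : ℕ} {p : Load n → Fin n → ℝ} {w : Load n → Fin n → ℕ} {q : ℝ} {M : ℕ}

/-- The product potential for reaching load `M`. -/
def missPot (q : ℝ) (M r : ℕ) (x : Load n) : ℝ := ∏ i, (1 - hitProb q M r (x i))

theorem missPot_nonneg (h0 : 0 ≤ q) (h1 : q ≤ 1) (r : ℕ) (x : Load n) : 0 ≤ missPot q M r x :=
  Finset.prod_nonneg fun i _ => sub_nonneg.2 (hitProb_le_one h0 h1 r (x i))

theorem missPot_anti (h0 : 0 ≤ q) (h1 : q ≤ 1) (r : ℕ) {x y : Load n} (hxy : x ≤ y) :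
    missPot q M r y ≤ missPot q M r x :=
  Finset.prod_le_prod (fun i _ => sub_nonneg.2 (hitProb_le_one h0 h1 r (y i)))
    fun i _ => sub_le_sub_left (hitProb_mono h0 h1 r (hxy i)) 1

theorem le_addBalls (x : Load n) (i : Fin n) (k : ℕ) : x ≤ addBalls x i k := by
  intro j
  unfold addBalls
  by_cases h : j = i
  · subst h; simp
  · simp [h]

theorem stepOp_missPot_le_self (h : Admissible p w) (h0 : 0 ≤ q) (h1 : q ≤ 1) (r : ℕ)
    (x : Load n) : stepOp p w (missPot q M r) x ≤ missPot q M r x := by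
  calc _ ≤ ∑ i, p x i * missPot q M r x := Finset.sum_le_sum fun i _ =>
        mul_le_mul_of_nonneg_left (missPot_anti h0 h1 r (le_addBalls x i _)) (h.nonneg x i)
    _ = _ := by rw [← Finset.sum_mul, h.sum_eq_one, one_mul]

/-- One round with selection probabilities at least `q` is at least as good for reaching `M` as one
independent trial in each bin. Extra balls and extra probability only help, by monotonicity of
`hitProb`. -/
theorem stepOp_missPot_le (h : Admissible p w) (h0 : 0 ≤ q) (h1 : q ≤ 1) (r : ℕ)
    (x : Load n) (hq : ∀ i, q ≤ p x i) :
    stepOp p w (missPot q M r) x ≤ missPot q M (r + 1) x := by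
  set a : Fin n → ℝ := fun i => 1 - hitProb q M r (x i) with ha
  set e : Fin n → ℝ := fun i => hitProb q M r (x i + 1) - hitProb q M r (x i) with he
  have ha0 : ∀ i, 0 ≤ a i := fun i => sub_nonneg.2 (hitProb_le_one h0 h1 r (x i))
  have he0 : ∀ i, 0 ≤ e i := fun i => sub_nonneg.2 (hitProb_mono h0 h1 r (Nat.le_succ _))
  have hea : ∀ i, e i ≤ a i := fun i => sub_le_sub_right (hitProb_le_one h0 h1 r _) _
  have h2 : ∀ i, missPot q M r (addBalls x i (w x i)) ≤
      ∏ j, a j - e i * ∏ j ∈ Finset.univ.erase i, a j := by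
    intro i
    unfold missPot
    rw [← Finset.mul_prod_erase _ _ (Finset.mem_univ i),
      ← Finset.mul_prod_erase _ a (Finset.mem_univ i), ← sub_mul]
    have e1 : ∏ j ∈ Finset.univ.erase i, (1 - hitProb q M r (addBalls x i (w x i) j)) =
        ∏ j ∈ Finset.univ.erase i, a j := by
      refine Finset.prod_congr rfl fun j hj => ?_
      rw [addBalls, Function.update_of_ne (Finset.ne_of_mem_erase hj)]
    rw [e1]
    refine mul_le_mul_of_nonneg_right ?_ (Finset.prod_nonneg fun j _ => ha0 j)
    rw [addBalls, Function.update_self]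
    have := hitProb_mono (M := M) h0 h1 r (Nat.add_le_add_left (h.one_le x i) (x i))
    simp only [ha, he]
    linarith
  calc stepOp p w (missPot q M r) x
      ≤ ∑ i, (p x i * ∏ j, a j - q * (e i * ∏ j ∈ Finset.univ.erase i, a j)) := by
        refine Finset.sum_le_sum fun i _ => ?_
        have h3 := mul_le_mul_of_nonneg_left (h2 i) (h.nonneg x i)
        have h4 := mul_le_mul_of_nonneg_right (hq i)
          (mul_nonneg (he0 i) (Finset.prod_nonneg fun j (_ : j ∈ Finset.univ.erase i) => ha0 j))
        linarith
    _ = ∏ j, a j - q * ∑ i, e i * ∏ j ∈ Finset.univ.erase i, a j := by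
        rw [Finset.sum_sub_distrib, ← Finset.sum_mul, h.sum_eq_one, one_mul, Finset.mul_sum]
    _ ≤ ∏ i, (a i - q * e i) := prod_sub_sum_le_prod_sub _ a e h0 h1 he0 hea
    _ = _ := Finset.prod_congr rfl fun i _ => by simp only [ha, he, hitProb]; ring

open Classical in
/-- Indicator of the event that all loads are below `M`. -/
def allBelow (M : ℕ) (x : Load n) : ℝ := if ∀ i, x i < M then 1 else 0

theorem missPot_zero (x : Load n) : missPot q M 0 x = allBelow M x := by
  unfold missPot allBelow hitProb
  split_ifs with hx
  · exact Finset.prod_eq_one fun i _ => by rw [if_neg (not_le.2 (hx i)), sub_zero]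
  · push Not at hx
    obtain ⟨i, hi⟩ := hx
    exact Finset.prod_eq_zero (Finset.mem_univ i) (by rw [if_pos hi, sub_self])

/-- Loads never decrease, so a bin that has reached `M` keeps `allBelow` at 0. The budget `B`
records that a round adds at most two balls, because `g` is controlled only for bounded total load.
-/
theorem stepOp_iterate_nonpos_of_hit (h : Admissible p w) {B : ℕ} {g : Load n → ℝ}
    (hg : ∀ x, totalLoad x ≤ B → g x ≤ allBelow M x) (s : ℕ) (x : Load n)
    (hB : totalLoad x + 2 * s ≤ B) (hx : ∃ i, M ≤ x i) : (stepOp p w)^[s] g x ≤ 0 := by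
  induction s generalizing x with
  | zero =>
    refine (hg x hB).trans (le_of_eq (if_neg ?_))
    push Not
    exact hx
  | succ s ih =>
    rw [Function.iterate_succ_apply']
    refine Finset.sum_nonpos fun i _ => mul_nonpos_of_nonneg_of_nonpos (h.nonneg x i) (ih _ ?_ ?_)
    · have := h.le_two x i
      rw [totalLoad_addBalls]; omega
    · obtain ⟨j, hj⟩ := hx
      exact ⟨j, hj.trans (le_addBalls x i _ j)⟩

theorem stepOp_iterate_le_missPot (h : Admissible p w) (h0 : 0 ≤ q) (h1 : q ≤ 1)
    (hq : ∀ x i, q ≤ p x i) {B : ℕ} {g : Load n → ℝ}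
    (hg : ∀ x, totalLoad x ≤ B → g x ≤ allBelow M x) (s : ℕ) (x : Load n)
    (hB : totalLoad x + 2 * s ≤ B) : (stepOp p w)^[s] g x ≤ missPot q M s x := by
  induction s generalizing x with
  | zero => rw [missPot_zero]; exact hg x hB
  | succ s ih =>
    rw [Function.iterate_succ_apply']
    refine le_trans (Finset.sum_le_sum fun i _ => mul_le_mul_of_nonneg_left (ih _ ?_)
      (h.nonneg x i)) (stepOp_missPot_le h h0 h1 s x (hq x))
    have := h.le_two x i
    rw [totalLoad_addBalls]; omega

/-! ### Mean-Thinning: rounds with few overloaded bins -/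

/-- The quadratic potential. -/
def sqPot (x : Load n) : ℝ := ∑ j, dev x j ^ 2

/-- The potential that decreases in rounds with few overloaded bins. -/
def fewOverPot (x : Load n) : ℝ := sqPot x / 16 - huberPot 10 x

theorem neg_le_fewOverPot (x : Load n) : -(1600 * n : ℝ) ≤ fewOverPot x := by
  have h1 : ∀ j, -1600 ≤ dev x j ^ 2 / 16 - huber 10 (dev x j) := by
    intro j
    have := huber_le (K := 10) (by norm_num) (dev x j)
    rw [← sq_abs (dev x j)]
    -- The function y²/16 - 20|y| attains its minimum -1600 at |y| = 160.
    nlinarith [sq_nonneg (|dev x j| - 160)]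
  calc -(1600 * n : ℝ) = ∑ _j : Fin n, (-1600 : ℝ) := by simp; ring
    _ ≤ ∑ j, (dev x j ^ 2 / 16 - huber 10 (dev x j)) := Finset.sum_le_sum fun j _ => h1 j
    _ = _ := by rw [Finset.sum_sub_distrib, ← Finset.sum_div]; rfl

theorem sqPot_addBalls [NeZero n] (x : Load n) (i : Fin n) :
    sqPot (addBalls x i 1) = sqPot x + 2 * dev x i + (1 - 1 / n) := by
  have hn : (n : ℝ) ≠ 0 := by exact_mod_cast NeZero.ne n
  have h1 : ∀ j, dev (addBalls x i 1) j ^ 2 = dev x j ^ 2 - 2 / n * dev x j + 1 / n ^ 2 +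
      if j = i then 2 * dev x i + 1 - 2 / n else 0 := by
    intro j
    rw [dev_addBalls]
    by_cases h : j = i
    · subst h; simp only [if_true, Nat.cast_one]; ring
    · simp only [if_neg h, Nat.cast_one]; ring
  unfold sqPot
  simp only [h1]
  rw [Finset.sum_add_distrib, Finset.sum_add_distrib, Finset.sum_sub_distrib, ← Finset.mul_sum,
    sum_dev, Finset.sum_ite_eq' Finset.univ i]
  simp
  field_simp
  ring

/-- Deviations sum to zero, so the underloaded bins carry half of the total absolute deviation, and
favouring them turns that mass into negative drift. -/
theorem stepOp_sqPot_le [NeZero n] (x : Load n) :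
    stepOp thinningProb (fun _ _ => 1) sqPot x ≤ sqPot x + 1 - (∑ j, |dev x j|) / n := by
  have hn : (0 : ℝ) < n := by exact_mod_cast Nat.pos_of_ne_zero (NeZero.ne n)
  have hA := (meanBiased_thinning n).toAdmissible
  have h1 : ∑ i, thinningProb x i * dev x i = -(∑ j, |dev x j|) / (2 * n) := by
    have : ∀ i, thinningProb x i * dev x i =
        (1 / n * (1 / 2) + overFrac x / n) * dev x i - 1 / (2 * n) * |dev x i| := by
      intro i
      unfold thinningProb
      split_ifs with h
      · rw [abs_of_neg h]; field_simp; ring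
      · rw [abs_of_nonneg (not_lt.1 h)]; field_simp; ring
    simp only [this]
    rw [Finset.sum_sub_distrib, ← Finset.mul_sum, sum_dev, ← Finset.mul_sum]
    ring
  calc stepOp thinningProb (fun _ _ => 1) sqPot x
      = ∑ i, (2 * (thinningProb x i * dev x i) +
          (sqPot x + (1 - 1 / n)) * thinningProb x i) := by
        refine Finset.sum_congr rfl fun i _ => ?_
        rw [sqPot_addBalls]; ring
    _ = sqPot x + 1 - (∑ j, |dev x j|) / n - 1 / n := by
        rw [Finset.sum_add_distrib, ← Finset.mul_sum, ← Finset.mul_sum, h1, hA.sum_eq_one]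
        field_simp
        ring
    _ ≤ _ := by
        have : 0 < 1 / (n : ℝ) := by positivity
        linarith

theorem stepOp_fewOverPot (x : Load n) : stepOp p w fewOverPot x =
    stepOp p w sqPot x / 16 - stepOp p w (huberPot 10) x := by
  unfold stepOp fewOverPot
  rw [Finset.sum_div, ← Finset.sum_sub_distrib]
  exact Finset.sum_congr rfl fun i _ => by ring

theorem stepOp_fewOverPot_le [NeZero n] (hn2 : 2 ≤ n) (x : Load n) :
    stepOp thinningProb (fun _ _ => 1) fewOverPot x ≤ fewOverPot x + 11 := by
  have h1 := stepOp_sqPot_le x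
  have h2 := (meanBiased_thinning n).huberPot_drift hn2 x (K := 10) (η := 10) (by norm_num)
    (by linarith [overFrac_mul_le x])
  have h3 : 0 ≤ (∑ j, |dev x j|) / n := by positivity
  rw [stepOp_fewOverPot, fewOverPot]
  linarith

theorem stepOp_fewOverPot_le_of_few [NeZero n] (hn2 : 2 ≤ n) (x : Load n)
    (hx : overFrac x ≤ 1 / 1280) :
    stepOp thinningProb (fun _ _ => 1) fewOverPot x ≤ fewOverPot x + -(1 / 32) := by
  have hn : (0 : ℝ) < n := by exact_mod_cast Nat.pos_of_ne_zero (NeZero.ne n)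
  have hMB := meanBiased_thinning n
  have h1 := stepOp_sqPot_le x
  have hδ0 := overFrac_nonneg x
  have hη : 4 * (10 : ℝ) * (overFrac x * (1 - overFrac x)) ≤ 1 / 32 := by nlinarith
  rw [stepOp_fewOverPot, fewOverPot]
  -- If the mean absolute deviation is at least 2, the quadratic part falls by 1/16, and the Huber
  -- loss costs at most 1/32. Otherwise the quadratic part rises by at most 1/16, but half of the
  -- bins are underloaded and within 8 of the mean, so the Huber potential rises by at least 1/8 -
  -- 1/32. Both give -1/32.
  by_cases hΔ : 2 ≤ (∑ j, |dev x j|) / n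
  · have h2 := hMB.huberPot_drift hn2 x (by norm_num) hη
    linarith
  · have hc : (n : ℝ) / 2 ≤ (Finset.univ.filter fun i => dev x i < 0 ∧ |dev x i| ≤ 8).card := by
      have c1 := card_under_div x
      rw [div_eq_iff hn.ne'] at c1
      have c2 : ((Finset.univ.filter fun i => 8 < |dev x i|).card : ℝ) ≤ n / 4 := by
        have c3 := Finset.card_nsmul_le_sum (Finset.univ.filter fun i => 8 < |dev x i|)
          (fun i => |dev x i|) 8 (fun i hi => (Finset.mem_filter.1 hi).2.le)
        have c4 := Finset.sum_le_sum_of_subset_of_nonneg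
          (Finset.filter_subset (fun i => 8 < |dev x i|) Finset.univ)
          (fun i _ _ => abs_nonneg (dev x i))
        rw [nsmul_eq_mul] at c3
        rw [not_le, div_lt_iff₀ hn] at hΔ
        linarith
      have c5 : (Finset.univ.filter fun i => dev x i < 0).card ≤
          (Finset.univ.filter fun i => dev x i < 0 ∧ |dev x i| ≤ 8).card +
          (Finset.univ.filter fun i => 8 < |dev x i|).card := by
        refine (Finset.card_le_card fun i hi => ?_).trans (Finset.card_union_le _ _)
        simp only [Finset.mem_union, Finset.mem_filter, Finset.mem_univ, true_and] at hi ⊢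
        rcases le_or_gt |dev x i| 8 with h | h
        · exact Or.inl ⟨hi, h⟩
        · exact Or.inr h
      have c6 : ((Finset.univ.filter fun i => dev x i < 0).card : ℝ) ≤
          (Finset.univ.filter fun i => dev x i < 0 ∧ |dev x i| ≤ 8).card +
          (Finset.univ.filter fun i => 8 < |dev x i|).card := by exact_mod_cast c5
      nlinarith
    have h2 := hMB.huberPot_drift_of_close hn2 x (b := 1) (by norm_num) hη _
      (fun j hj => (Finset.mem_filter.1 hj).2.2.trans (by norm_num)) hc (by norm_num)
      (fun j hj => hMB.le_mul_sq_under x j (Finset.mem_filter.1 hj).2.1)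
    have h3 : 0 ≤ (∑ j, |dev x j|) / n := by positivity
    linarith

theorem abs_fewOverPot_addBalls_sub_le [NeZero n] (x : Load n) (i : Fin n) (hM : |dev x i| ≤ M) :
    |fewOverPot (addBalls x i 1) - fewOverPot x| ≤ M + 41 := by
  have hn : (1 : ℝ) ≤ n := by exact_mod_cast Nat.pos_of_ne_zero (NeZero.ne n)
  have h1 := abs_huberPot_addBalls_sub_le (K := 10) (by norm_num) x i 1
  rw [Nat.cast_one, mul_one] at h1
  have h2 : 0 < 1 / (n : ℝ) := by positivity
  have h3 : 1 / (n : ℝ) ≤ 1 := by rw [div_le_one] <;> linarith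
  have hM0 : (0 : ℝ) ≤ M := Nat.cast_nonneg M
  rw [fewOverPot, fewOverPot, sqPot_addBalls]
  rw [abs_le] at h1 hM ⊢
  constructor <;> linarith

theorem stepOp_exp_le [NeZero n] (h : Admissible p w) {F : Load n → ℝ} {l J d : ℝ} (hl : 0 ≤ l)
    (hlJ : l * J ≤ 1) (x : Load n)
    (hJ : ∀ i, |F (addBalls x i (w x i)) - F x| ≤ J) (hF : stepOp p w F x ≤ F x + d) :
    stepOp p w (fun x => Real.exp (l * F x)) x ≤
      Real.exp (l * F x) * (1 + l * d + (l * J) ^ 2) := by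
  have h1 : ∀ i, Real.exp (l * F (addBalls x i (w x i))) ≤ Real.exp (l * F x) *
      (l * F (addBalls x i (w x i)) + (1 - l * F x + (l * J) ^ 2)) := by
    intro i
    have hb : |l * (F (addBalls x i (w x i)) - F x)| ≤ l * J := by
      rw [abs_mul, abs_of_nonneg hl]
      exact mul_le_mul_of_nonneg_left (hJ i) hl
    have hq := exp_le_quadratic (hb.trans hlJ)
    have hs : (l * (F (addBalls x i (w x i)) - F x)) ^ 2 ≤ (l * J) ^ 2 := by
      rw [← sq_abs]
      exact pow_le_pow_left₀ (abs_nonneg _) hb 2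
    have e : l * F (addBalls x i (w x i)) = l * F x + l * (F (addBalls x i (w x i)) - F x) := by
      ring
    rw [e, Real.exp_add]
    refine mul_le_mul_of_nonneg_left ?_ (Real.exp_pos _).le
    linarith
  calc _ ≤ ∑ i, p x i * (Real.exp (l * F x) *
      (l * F (addBalls x i (w x i)) + (1 - l * F x + (l * J) ^ 2))) :=
        Finset.sum_le_sum fun i _ => mul_le_mul_of_nonneg_left (h1 i) (h.nonneg x i)
    _ = Real.exp (l * F x) * stepOp p w (fun x' => l * F x' + (1 - l * F x + (l * J) ^ 2)) x := by
        unfold stepOp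
        rw [Finset.mul_sum]
        exact Finset.sum_congr rfl fun i _ => by ring
    _ = Real.exp (l * F x) * (l * stepOp p w F x + (1 - l * F x + (l * J) ^ 2)) := by
        rw [stepOp_affine h.sum_eq_one]
    _ ≤ _ := by
        refine mul_le_mul_of_nonneg_left ?_ (Real.exp_pos _).le
        have := mul_le_mul_of_nonneg_left hF hl
        linarith

theorem abs_dev_le [NeZero n] (x : Load n) (hx : ∀ i, x i < M) (hW : totalLoad x ≤ n * M)
    (i : Fin n) : |dev x i| ≤ M := by
  have hn : (0 : ℝ) < n := by exact_mod_cast Nat.pos_of_ne_zero (NeZero.ne n)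
  have h1 : (x i : ℝ) ≤ M := by exact_mod_cast (hx i).le
  have h2 : (totalLoad x : ℝ) / n ≤ M := by
    rw [div_le_iff₀ hn, mul_comm]
    exact_mod_cast hW
  have h3 : (0 : ℝ) ≤ x i := Nat.cast_nonneg _
  have h4 : (0 : ℝ) ≤ (totalLoad x : ℝ) / n := by positivity
  rw [dev, abs_le]
  constructor <;> linarith

/-- With `s` rounds left, load `M` is missed either despite `r` useful rounds (overloaded fraction
above 1/1280), bounded by `missPot`, or because useful rounds are too rare. The exponential term
bounds the latter: useless rounds push `fewOverPot` down by 1/32 on average, while useful ones raise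
it by at most 11, and it cannot go below -1600n. The rates 1/64 and 13 leave room for the
second-order error. -/
theorem stepOp_iterate_thinning_le [NeZero n] (hn2 : 2 ≤ n) {B : ℕ} (hBM : B ≤ n * M)
    {g : Load n → ℝ} (hg1 : ∀ x, g x ≤ 1)
    (hg : ∀ x, totalLoad x ≤ B → g x ≤ allBelow M x) (s r : ℕ) (x : Load n)
    (hB : totalLoad x + 2 * s ≤ B) :
    (stepOp thinningProb (fun _ _ => 1))^[s] g x ≤ missPot (1 / 1280 / n) M r x +
      Real.exp (1 / (64 * (M + 41) ^ 2) * (fewOverPot x + 1600 * n - s / 64 + 13 * r)) := by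
  have hn : (2 : ℝ) ≤ n := by exact_mod_cast hn2
  have hA := (meanBiased_thinning n).toAdmissible
  have hq0 : (0 : ℝ) ≤ 1 / 1280 / n := by positivity
  have hq1 : (1 : ℝ) / 1280 / n ≤ 1 := by
    rw [div_le_one (by linarith)]; linarith
  set l : ℝ := 1 / (64 * (M + 41) ^ 2) with hl
  have hM0 : (0 : ℝ) ≤ M := Nat.cast_nonneg M
  have hl0 : 0 < l := by positivity
  -- The choice of `l` makes the second-order error, for jumps of size `M + 41`, equal to l/64.
  have hlJ2 : (l * (M + 41)) ^ 2 = l / 64 := by rw [hl]; field_simp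
  have hlJ : l * (M + 41) ≤ 1 := by
    rw [hl, one_div_mul_eq_div, div_le_one (by positivity)]; nlinarith
  have hone : ∀ s x, (stepOp thinningProb (fun _ _ => 1))^[s] g x ≤ 1 := by
    intro s x
    have hc := stepOp_iterate_mono (w := fun _ _ => 1) hA.nonneg s
      (g' := fun x => 0 * g x + 1) (fun x => by simpa using hg1 x) x
    rw [stepOp_iterate_affine hA.sum_eq_one] at hc
    linarith
  induction s generalizing r x with
  | zero =>
    refine (hone 0 x).trans ?_
    have h1 := neg_le_fewOverPot x
    have h2 := missPot_nonneg (M := M) hq0 hq1 r x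
    have h3 : 1 ≤ Real.exp (l * (fewOverPot x + 1600 * n - (0 : ℕ) / 64 + 13 * r)) := by
      refine Real.one_le_exp (mul_nonneg hl0.le ?_)
      have : (0 : ℝ) ≤ r := Nat.cast_nonneg r
      push_cast
      linarith
    linarith
  | succ s ih =>
    have hm0 := missPot_nonneg (M := M) hq0 hq1 r x
    -- Once `M` is reached nothing remains to be bounded; before that, all deviations are at most
    -- `M`, which is what the jump bound needs.
    by_cases hx : ∃ i, M ≤ x i
    · exact (stepOp_iterate_nonpos_of_hit hA hg (s + 1) x hB hx).trans
        (add_nonneg hm0 (Real.exp_pos _).le)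
    push Not at hx
    have hdev := abs_dev_le x hx (by omega)
    rw [Function.iterate_succ_apply']
    have main : ∀ (r' : ℕ) (d : ℝ),
        stepOp thinningProb (fun _ _ => 1) (missPot (1 / 1280 / n) M r') x ≤
          missPot (1 / 1280 / n) M r x →
        stepOp thinningProb (fun _ _ => 1) fewOverPot x ≤ fewOverPot x + d →
        d + 1 / 64 + 13 * r' + 1 / 64 ≤ 13 * r →
        stepOp thinningProb (fun _ _ => 1) ((stepOp thinningProb (fun _ _ => 1))^[s] g) x ≤
          missPot (1 / 1280 / n) M r x +
          Real.exp (l * (fewOverPot x + 1600 * n - (s + 1 : ℕ) / 64 + 13 * r)) := by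
      intro r' d hmiss hF hd
      have hE := stepOp_exp_le hA hl0.le hlJ x
        (fun i => abs_fewOverPot_addBalls_sub_le x i (hdev i)) hF
      calc _ ≤ ∑ i, thinningProb x i * (missPot (1 / 1280 / n) M r' (addBalls x i 1) +
            Real.exp (l * (fewOverPot (addBalls x i 1) + 1600 * n - s / 64 + 13 * r'))) := by
            refine Finset.sum_le_sum fun i _ => mul_le_mul_of_nonneg_left (ih r' _ ?_)
              (hA.nonneg x i)
            rw [totalLoad_addBalls]; dsimp only; omega
        _ = stepOp thinningProb (fun _ _ => 1) (missPot (1 / 1280 / n) M r') x +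
            Real.exp (l * (1600 * n - s / 64 + 13 * r')) *
              stepOp thinningProb (fun _ _ => 1) (fun x => Real.exp (l * fewOverPot x)) x := by
            unfold stepOp
            rw [Finset.mul_sum, ← Finset.sum_add_distrib]
            refine Finset.sum_congr rfl fun i _ => ?_
            rw [show l * (fewOverPot (addBalls x i 1) + 1600 * n - s / 64 + 13 * r') =
              l * (1600 * n - s / 64 + 13 * r') + l * fewOverPot (addBalls x i 1) by ring,
              Real.exp_add]
            ring
        _ ≤ missPot (1 / 1280 / n) M r x + Real.exp (l * (1600 * n - s / 64 + 13 * r')) *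
            (Real.exp (l * fewOverPot x) * Real.exp (l * d + l / 64)) := by
            refine add_le_add hmiss (mul_le_mul_of_nonneg_left (hE.trans ?_) (Real.exp_pos _).le)
            refine mul_le_mul_of_nonneg_left ?_ (Real.exp_pos _).le
            rw [hlJ2]
            linarith [Real.add_one_le_exp (l * d + l / 64)]
        _ ≤ _ := by
            rw [← Real.exp_add, ← Real.exp_add]
            refine add_le_add_right (Real.exp_le_exp.2 ?_) _
            rw [show l * (1600 * n - s / 64 + 13 * r') + (l * fewOverPot x + (l * d + l / 64)) =
              l * (1600 * n - s / 64 + 13 * r' + fewOverPot x + d + 1 / 64) by ring]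
            refine mul_le_mul_of_nonneg_left ?_ hl0.le
            push_cast
            linarith
    by_cases hfew : overFrac x ≤ 1 / 1280
    · exact main r (-(1 / 32)) (stepOp_missPot_le_self hA hq0 hq1 r x)
        (stepOp_fewOverPot_le_of_few hn2 x hfew) (by linarith)
    · cases r with
      -- No useful round remains to be counted: `missPot` equals 1 here and the bound is trivial.
      | zero =>
        have := hone (s + 1) x
        rw [Function.iterate_succ_apply'] at this
        rw [missPot_zero, allBelow, if_pos hx]
        exact this.trans (le_add_of_nonneg_right (Real.exp_pos _).le)
      | succ r =>
        refine main r 11 (stepOp_missPot_le hA hq0 hq1 r x fun i => ?_)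
          (stepOp_fewOverPot_le hn2 x) (by push_cast; linarith)
        unfold thinningProb
        gcongr
        split_ifs <;> linarith

end Hitting

/-! ### The lower bounds -/

/-- The constant in the lower bound. -/
def lowerConst (q : ℝ) : ℝ := 1 / (2 * (3 * Real.log (32000 / q) + 1))

section LowerConst

variable {q : ℝ}

theorem log_div_pos (h0 : 0 < q) (h1 : q ≤ 1 / 2) : 0 < Real.log (32000 / q) :=
  Real.log_pos (by rw [lt_div_iff₀ h0]; linarith)

theorem lowerConst_pos (h0 : 0 < q) (h1 : q ≤ 1 / 2) : 0 < lowerConst q := by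
  have := log_div_pos h0 h1
  unfold lowerConst
  positivity

theorem lowerConst_le (h0 : 0 < q) (h1 : q ≤ 1 / 2) : lowerConst q ≤ 1 / 2 := by
  have := log_div_pos h0 h1
  unfold lowerConst
  exact one_div_le_one_div_of_le (by norm_num) (by linarith)

/-- A lower bound on `log n` beyond which the estimates for the lower bound hold. -/
def logThreshold (q : ℝ) : ℝ := 10 ^ 6 / lowerConst q + 512000 / q

variable {n : ℕ}

theorem bounds_of_logThreshold_le (h0 : 0 < q) (h1 : q ≤ 1 / 2)
    (hL : logThreshold q ≤ Real.log n) : 10 ^ 6 ≤ lowerConst q * Real.log n ∧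
      512000 ≤ q * Real.log n ∧ 10 ^ 6 ≤ Real.log n ∧ (10 ^ 6 : ℝ) ≤ n ∧
      (n : ℝ) = Real.exp (Real.log n) := by
  have hκ := lowerConst_pos h0 h1
  have hκ' := lowerConst_le h0 h1
  have e1 : 10 ^ 6 / lowerConst q ≤ Real.log n := by
    have : 0 < 512000 / q := by positivity
    unfold logThreshold at hL; linarith
  have e2 : 512000 / q ≤ Real.log n := by
    have : 0 < 10 ^ 6 / lowerConst q := by positivity
    unfold logThreshold at hL; linarith
  rw [div_le_iff₀ hκ] at e1
  rw [div_le_iff₀ h0] at e2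
  have e3 : 10 ^ 6 ≤ Real.log n := by
    have : 0 ≤ Real.log n := by nlinarith
    nlinarith
  have hn0 : (n : ℝ) ≠ 0 := by
    rintro h
    rw [h, Real.log_zero] at e3
    norm_num at e3
  have hn : (0 : ℝ) < n := lt_of_le_of_ne (Nat.cast_nonneg n) hn0.symm
  refine ⟨by linarith, by linarith, e3, ?_, (Real.exp_log hn).symm⟩
  have := Real.log_le_sub_one_of_pos hn
  linarith

/-- `lowerConst` is chosen so that κ(3ℓ + 1) = 1/2 with ℓ = log(32000/q). The binomial term for M ≈
3κ log n successes then costs only a factor n^(-1/2), up to the constant exp(-ℓ). -/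
theorem exp_le_hitProb (h0 : 0 < q) (h1 : q ≤ 1 / 2) (hL : logThreshold q ≤ Real.log n) {R : ℕ}
    (hR1 : lowerConst q * n * Real.log n / 4000 ≤ R) (hR2 : R ≤ lowerConst q * n * Real.log n) :
    Real.exp (-Real.log (32000 / q) - Real.log n / 2) ≤
      hitProb (q / n) ⌈3 * lowerConst q * Real.log n⌉₊ R 0 := by
  obtain ⟨b1, b2, b3, b4, b5⟩ := bounds_of_logThreshold_le h0 h1 hL
  have hκ := lowerConst_pos h0 h1
  have hℓ := log_div_pos h0 h1
  set κ := lowerConst q with hκdef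
  set L := Real.log n with hLdef
  set ℓ := Real.log (32000 / q) with hℓdef
  set M := ⌈3 * κ * L⌉₊ with hM
  have hn : (0 : ℝ) < n := by linarith
  have hM1 : 3 * κ * L ≤ M := Nat.le_ceil _
  have hM2 : (M : ℝ) < 3 * κ * L + 1 := Nat.ceil_lt_add_one (by nlinarith)
  have hM0 : (0 : ℝ) < M := by linarith
  have hRM : 2 * (M : ℝ) ≤ R := by nlinarith
  have hRM' : 2 * M ≤ R := by exact_mod_cast hRM
  have hq0 : 0 ≤ q / n := by positivity
  have hq2 : q / n ≤ 1 / 2 := (div_le_self h0.le (by linarith)).trans h1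
  have hchoose : ((R : ℝ) / (2 * M)) ^ M ≤ R.choose M := by
    refine le_trans ?_ (Nat.pow_le_choose M R)
    have c1 : (R : ℝ) / 2 ≤ ((R + 1 - M : ℕ) : ℝ) := by
      rw [Nat.cast_sub (by omega)]; push_cast; linarith
    have c2 : ((Nat.factorial M : ℕ) : ℝ) ≤ (M : ℝ) ^ M := by
      exact_mod_cast Nat.factorial_le_pow M
    rw [← div_div, div_pow]
    have c3 : (0 : ℝ) < (Nat.factorial M : ℕ) := by exact_mod_cast Nat.factorial_pos M
    gcongr
  have hv : q / 32000 = Real.exp (-ℓ) := by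
    rw [Real.exp_neg, hℓdef, Real.exp_log (by positivity), inv_div]
  have hpow1 : Real.exp (-ℓ * (3 * κ * L + 1)) ≤ R.choose M * (q / n) ^ M := by
    calc Real.exp (-ℓ * (3 * κ * L + 1)) ≤ Real.exp (M * -ℓ) := Real.exp_le_exp.2 (by nlinarith)
      _ = (q / 32000) ^ M := by rw [Real.exp_nat_mul, hv]
      _ ≤ ((R : ℝ) / (2 * M) * (q / n)) ^ M := by
          refine pow_le_pow_left₀ (by positivity) ?_ M
          rw [div_mul_div_comm, div_le_div_iff₀ (by norm_num) (by positivity)]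
          -- Here M ≤ 4κL and R ≥ κnL/4000, so 2Mn ≤ 8κnL ≤ 32000R.
          have : 2 * M * n ≤ 32000 * (R : ℝ) := by nlinarith
          nlinarith
      _ = ((R : ℝ) / (2 * M)) ^ M * (q / n) ^ M := mul_pow _ _ _
      _ ≤ _ := mul_le_mul_of_nonneg_right hchoose (by positivity)
  have hpow2 : Real.exp (-(κ * L)) ≤ (1 - q / n) ^ R := by
    have h2 : Real.exp (-(2 * (q / n))) ≤ 1 - q / n := by
      rw [Real.exp_neg, inv_le_comm₀ (Real.exp_pos _) (by linarith)]
      refine le_trans ?_ (Real.add_one_le_exp _)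
      rw [inv_le_iff_one_le_mul₀ (by linarith)]
      nlinarith
    calc Real.exp (-(κ * L)) ≤ Real.exp (R * -(2 * (q / n))) := by
          refine Real.exp_le_exp.2 ?_
          have : R * (q / n) ≤ κ * n * L * (q / n) := mul_le_mul_of_nonneg_right hR2 hq0
          have e : κ * n * L * (q / n) = κ * L * q := by field_simp
          nlinarith
      _ = Real.exp (-(2 * (q / n))) ^ R := Real.exp_nat_mul _ _
      _ ≤ _ := pow_le_pow_left₀ (Real.exp_pos _).le h2 R
  refine le_trans ?_ (choose_mul_le_hitProb hq0 (by linarith) R 0 M (zero_add M))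
  calc Real.exp (-ℓ - L / 2) = Real.exp (-ℓ * (3 * κ * L + 1)) * Real.exp (-(κ * L)) := by
        rw [← Real.exp_add]
        congr 1
        have : κ * (3 * ℓ + 1) = 1 / 2 := by
          rw [hκdef, lowerConst, ← hℓdef]
          field_simp
        linear_combination L * this
    _ ≤ _ := mul_le_mul hpow1 hpow2 (Real.exp_pos _).le (by positivity)

/-- The n bins give the power (1 - f)^n ≤ exp(-nf), where nf is at least of order √n and so exceeds
2 log n. -/
theorem missPot_start_le (h0 : 0 < q) (h1 : q ≤ 1 / 2) (hL : logThreshold q ≤ Real.log n) {R : ℕ}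
    (hR1 : lowerConst q * n * Real.log n / 4000 ≤ R) (hR2 : R ≤ lowerConst q * n * Real.log n) :
    missPot (q / n) ⌈3 * lowerConst q * Real.log n⌉₊ R (0 : Load n) ≤ (n : ℝ)⁻¹ / 2 := by
  obtain ⟨-, b2, b3, b4, b5⟩ := bounds_of_logThreshold_le h0 h1 hL
  have hf := exp_le_hitProb h0 h1 hL hR1 hR2
  have hn : (0 : ℝ) < n := by linarith
  have hf1 := hitProb_le_one (M := ⌈3 * lowerConst q * Real.log n⌉₊) (q := q / n) (by positivity)
    ((div_le_self h0.le (by linarith)).trans (by linarith)) R 0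
  set f := hitProb (q / n) ⌈3 * lowerConst q * Real.log n⌉₊ R 0 with hfdef
  set L := Real.log n with hLdef
  have hnf : 2 * L ≤ n * f := by
    have g1 : Real.exp (-Real.log (32000 / q)) = q / 32000 := by
      rw [Real.exp_neg, Real.exp_log (by positivity), inv_div]
    have g2 := Real.quadratic_le_exp_of_nonneg (x := L / 2) (by linarith)
    calc 2 * L ≤ q / 32000 * Real.exp (L / 2) := by
          have : q / 32000 * (L ^ 2 / 8) ≤ q / 32000 * Real.exp (L / 2) :=
            mul_le_mul_of_nonneg_left (by nlinarith) (by positivity)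
          nlinarith
      _ = Real.exp L * Real.exp (-Real.log (32000 / q) - L / 2) := by
          rw [← g1, ← Real.exp_add, ← Real.exp_add]; congr 1; ring
      _ ≤ n * f := by rw [← b5]; exact mul_le_mul_of_nonneg_left hf hn.le
  have h2 : (2 : ℝ) ≤ Real.exp L := by rw [← b5]; linarith
  calc missPot (q / n) _ R (0 : Load n) = (1 - f) ^ n := by simp [missPot, hfdef]
    _ ≤ Real.exp (-f) ^ n := pow_le_pow_left₀ (by linarith) (Real.one_sub_le_exp_neg f) n
    _ = Real.exp (n * -f) := (Real.exp_nat_mul _ _).symm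
    _ ≤ Real.exp (-(2 * L)) := Real.exp_le_exp.2 (by linarith)
    _ = (Real.exp L)⁻¹ * (Real.exp L)⁻¹ := by
        rw [← Real.exp_neg, ← Real.exp_add]; congr 1; ring
    _ ≤ (Real.exp L)⁻¹ * 2⁻¹ := by gcongr
    _ = _ := by rw [← b5]; ring

/-- After T ≤ κ n log n rounds with at most two balls each, the mean load is at most 2κ log n. A bin
with load at least 3κ log n therefore forces a gap of at least κ log n, so it suffices to bound the
probability that all bins stay below M. -/
theorem lower_bound_of_iterate_le {Q : AllocProcess} (h0 : 0 < q) (h1 : q ≤ 1 / 2)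
    {p : ∀ (n : ℕ) [NeZero n], Load n → Fin n → ℝ}
    {w : ∀ (n : ℕ) [NeZero n], Load n → Fin n → ℕ}
    (hQ : ∀ (n : ℕ) [NeZero n], Represents Q n (p n) (w n))
    (h : ∀ (n : ℕ) [NeZero n], Admissible (p n) (w n))
    (hle : ∀ (n : ℕ) [NeZero n], logThreshold q ≤ Real.log n → ∀ (T M : ℕ),
      T = ⌊lowerConst q * n * Real.log n⌋₊ → M = ⌈3 * lowerConst q * Real.log n⌉₊ →
      2 * T ≤ n * M → ∀ g : Load n → ℝ, (∀ x, g x ≤ 1) →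
      (∀ x, totalLoad x ≤ 2 * T → g x ≤ allBelow M x) →
      (stepOp (p n) (w n))^[T] g 0 ≤ (n : ℝ)⁻¹) :
    ∃ κ : ℝ, 0 < κ ∧ ∃ N : ℕ, ∀ (n : ℕ) [NeZero n], N ≤ n →
      1 - (n : ℝ)⁻¹ ≤ gapProb Q n ⌊κ * n * Real.log n⌋₊ (fun g => κ * Real.log n ≤ g) := by
  classical
  have hκ := lowerConst_pos h0 h1
  refine ⟨lowerConst q, hκ, ⌈Real.exp (logThreshold q)⌉₊, fun n _ hN => ?_⟩
  have hL : logThreshold q ≤ Real.log n := by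
    have h2 := Nat.ceil_le.1 hN
    exact (Real.le_log_iff_exp_le (lt_of_lt_of_le (Real.exp_pos _) h2)).2 h2
  obtain ⟨b1, -, b3, b4, -⟩ := bounds_of_logThreshold_le h0 h1 hL
  have hn : (0 : ℝ) < n := by linarith
  refine one_sub_le_gapProb (hQ n) (h n) _ (fun g => g < lowerConst q * Real.log n) _
    (fun g => not_lt.symm) ?_
  rw [gapProb_eq (hQ n) (h n).nonneg]
  have hT : (⌊lowerConst q * n * Real.log n⌋₊ : ℝ) ≤ lowerConst q * n * Real.log n :=
    Nat.floor_le (by positivity)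
  have hM : 3 * lowerConst q * Real.log n ≤ (⌈3 * lowerConst q * Real.log n⌉₊ : ℝ) :=
    Nat.le_ceil _
  refine hle n hL _ _ rfl rfl ?_ _ (fun x => by split_ifs <;> norm_num) fun x hx => ?_
  · have : 2 * (⌊lowerConst q * n * Real.log n⌋₊ : ℝ) ≤
        n * (⌈3 * lowerConst q * Real.log n⌉₊ : ℝ) := by
      have := mul_le_mul_of_nonneg_left hM hn.le
      have : 0 < lowerConst q * n * Real.log n := by positivity
      nlinarith
    exact_mod_cast this
  · unfold allBelow
    split_ifs with hg hb
    · exact le_rfl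
    · exfalso
      refine hb fun i => ?_
      have hi : (x i : ℝ) ≤ ((Finset.univ.sup' Finset.univ_nonempty x : ℕ) : ℝ) := by
        exact_mod_cast Finset.le_sup' x (Finset.mem_univ i)
      have hW : (totalLoad x : ℝ) / n ≤ 2 * (lowerConst q * Real.log n) := by
        rw [div_le_iff₀ hn]
        have : (totalLoad x : ℝ) ≤ 2 * (⌊lowerConst q * n * Real.log n⌋₊ : ℝ) := by
          exact_mod_cast hx
        linarith
      unfold gap at hg
      have : (x i : ℝ) < (⌈3 * lowerConst q * Real.log n⌉₊ : ℝ) := by linarith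
      exact_mod_cast this
    · norm_num
    · exact le_rfl

theorem floor_bounds (h0 : 0 < q) (h1 : q ≤ 1 / 2) (hL : logThreshold q ≤ Real.log n) :
    (⌊lowerConst q * n * Real.log n⌋₊ : ℝ) ≤ lowerConst q * n * Real.log n ∧
    lowerConst q * n * Real.log n - 1 ≤ (⌊lowerConst q * n * Real.log n⌋₊ : ℝ) ∧
    10 ^ 6 * (n : ℝ) ≤ lowerConst q * n * Real.log n := by
  obtain ⟨b1, -, b3, b4, -⟩ := bounds_of_logThreshold_le h0 h1 hL
  have hκ := lowerConst_pos h0 h1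
  refine ⟨Nat.floor_le (by positivity), (Nat.sub_one_lt_floor _).le, ?_⟩
  nlinarith

theorem lower_bound_of_le_prob {Q : AllocProcess} (h0 : 0 < q) (h1 : q ≤ 1 / 2)
    {p : ∀ (n : ℕ) [NeZero n], Load n → Fin n → ℝ}
    {w : ∀ (n : ℕ) [NeZero n], Load n → Fin n → ℕ}
    (hQ : ∀ (n : ℕ) [NeZero n], Represents Q n (p n) (w n))
    (h : ∀ (n : ℕ) [NeZero n], Admissible (p n) (w n))
    (hp : ∀ (n : ℕ) [NeZero n] (x : Load n) (i : Fin n), q / n ≤ p n x i) :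
    ∃ κ : ℝ, 0 < κ ∧ ∃ N : ℕ, ∀ (n : ℕ) [NeZero n], N ≤ n →
      1 - (n : ℝ)⁻¹ ≤ gapProb Q n ⌊κ * n * Real.log n⌋₊ (fun g => κ * Real.log n ≤ g) := by
  refine lower_bound_of_iterate_le h0 h1 hQ h ?_
  rintro n _ hL T M rfl rfl - g - hg
  obtain ⟨-, -, -, b4, -⟩ := bounds_of_logThreshold_le h0 h1 hL
  obtain ⟨f1, f2, f3⟩ := floor_bounds h0 h1 hL
  have hn : (0 : ℝ) < n := by linarith
  have hm := stepOp_iterate_le_missPot (q := q / n) (h n) (by positivity)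
    ((div_le_self h0.le (by linarith)).trans (by linarith)) (hp n) hg
    ⌊lowerConst q * n * Real.log n⌋₊ 0 (by simp [totalLoad])
  refine hm.trans ((missPot_start_le h0 h1 hL (by linarith) f1).trans ?_)
  have : (0 : ℝ) < (n : ℝ)⁻¹ := by positivity
  linarith

theorem lower_bound_twinning : ∃ κ : ℝ, 0 < κ ∧ ∃ N : ℕ, ∀ (n : ℕ) [NeZero n], N ≤ n →
    1 - (n : ℝ)⁻¹ ≤ gapProb twinning n ⌊κ * n * Real.log n⌋₊ (fun g => κ * Real.log n ≤ g) :=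
  lower_bound_of_le_prob (q := 1 / 2) (by norm_num) le_rfl represents_twinning
    (fun n _ => (meanBiased_twinning n).toAdmissible) fun n _ x i => by
      rw [← one_div]
      gcongr
      norm_num

theorem lower_bound_onePlusBeta {β : ℝ≥0} (hβ : β < 1) :
    ∃ κ : ℝ, 0 < κ ∧ ∃ N : ℕ, ∀ (n : ℕ) [NeZero n], N ≤ n →
      1 - (n : ℝ)⁻¹ ≤ gapProb (onePlusBeta β hβ.le) n ⌊κ * n * Real.log n⌋₊
        (fun g => κ * Real.log n ≤ g) := by
  have h1 : (β : ℝ) < 1 := by exact_mod_cast hβ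
  have h0 : (0 : ℝ) ≤ β := β.2
  refine lower_bound_of_le_prob (q := (1 - β) / 2) (by linarith) (by linarith)
    (represents_onePlusBeta β hβ.le) (fun n _ => admissible_mixed hβ.le) fun n _ x i => ?_
  have h2 := mul_nonneg h0 (twoChoiceProb_nonneg x i)
  have h3 : (1 - (β : ℝ)) / 2 / n ≤ (1 - β) / n := by
    gcongr
    linarith
  unfold mixedProb
  linarith

/-- Here r = T/2000 useful rounds are demanded. That is few enough for the failure term to be
negligible and, up to rounding, enough for the hypothesis R ≥ κ n log n / 4000 of
`missPot_start_le`. -/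
theorem lower_bound_meanThinning : ∃ κ : ℝ, 0 < κ ∧ ∃ N : ℕ, ∀ (n : ℕ) [NeZero n], N ≤ n →
    1 - (n : ℝ)⁻¹ ≤ gapProb meanThinning n ⌊κ * n * Real.log n⌋₊
      (fun g => κ * Real.log n ≤ g) := by
  have h0 : (0 : ℝ) < 1 / 1280 := by norm_num
  have h1 : (1 / 1280 : ℝ) ≤ 1 / 2 := by norm_num
  refine lower_bound_of_iterate_le h0 h1 represents_meanThinning
    (fun n _ => (meanBiased_thinning n).toAdmissible) ?_
  intro n _ hL T M hT hM hTM g hg1 hg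
  obtain ⟨b1, -, b3, b4, b5⟩ := bounds_of_logThreshold_le h0 h1 hL
  obtain ⟨f1, f2, f3⟩ := floor_bounds h0 h1 hL
  have hκ' := lowerConst_le h0 h1
  have hκ := lowerConst_pos h0 h1
  rw [← hT] at f1 f2
  have hn : (0 : ℝ) < n := by linarith
  have hn2 : 2 ≤ n := by
    have : (2 : ℝ) ≤ n := by linarith
    exact_mod_cast this
  have hR1 : ((T / 2000 : ℕ) : ℝ) ≤ T / 2000 := Nat.cast_div_le
  have hR2 : (T : ℝ) / 2000 - 1 ≤ ((T / 2000 : ℕ) : ℝ) := by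
    have : T ≤ 2000 * (T / 2000) + 2000 := by omega
    have : (T : ℝ) ≤ 2000 * ((T / 2000 : ℕ) : ℝ) + 2000 := by exact_mod_cast this
    linarith
  have hm := stepOp_iterate_thinning_le hn2 hTM hg1 hg T (T / 2000) 0 (by simp [totalLoad])
  have hs := missPot_start_le h0 h1 hL (R := T / 2000) (by linarith) (by linarith)
  rw [← hM] at hs
  have hz : fewOverPot (0 : Load n) = 0 := by
    simp [fewOverPot, sqPot, huberPot, huber, dev, totalLoad]
  rw [hz] at hm
  set L := Real.log n with hLdef
  have hM2 : (M : ℝ) + 41 ≤ 2 * L := by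
    have h2 : (M : ℝ) < 3 * lowerConst (1 / 1280) * L + 1 := by
      rw [hM]; exact Nat.ceil_lt_add_one (by positivity)
    nlinarith
  have hM0 : (0 : ℝ) ≤ M := Nat.cast_nonneg M
  have hnL : L ^ 4 / 384 ≤ n := by
    have g2 := Real.quadratic_le_exp_of_nonneg (x := L / 2) (by linarith)
    have g3 : L ^ 2 / 8 ≤ Real.exp (L / 2) := by nlinarith
    have g4 := pow_le_pow_left₀ (by positivity) g3 2
    rw [← Real.exp_nat_mul] at g4
    have e : ((2 : ℕ) : ℝ) * (L / 2) = L := by push_cast; ring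
    rw [e, ← b5] at g4
    have : 0 ≤ L ^ 4 := by positivity
    nlinarith
  have hexp : Real.exp (1 / (64 * ((M : ℝ) + 41) ^ 2) *
      (0 + 1600 * n - T / 64 + 13 * (T / 2000 : ℕ))) ≤ (n : ℝ)⁻¹ / 2 := by
    -- Since 1/64 - 13/2000 > 0.009 and T is at least 10⁶n - 1, the decrease outweighs 3200n.
    have e1 : 0 + 1600 * (n : ℝ) - T / 64 + 13 * (T / 2000 : ℕ) ≤ -(1600 * n) := by linarith
    have e2 : 1 / (64 * (2 * L) ^ 2) ≤ 1 / (64 * ((M : ℝ) + 41) ^ 2) := by gcongr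
    have e3 : 2 * L ≤ 1 / (64 * ((M : ℝ) + 41) ^ 2) * (1600 * n) := by
      calc 2 * L ≤ 1 / (64 * (2 * L) ^ 2) * (1600 * n) := by
            rw [one_div_mul_eq_div, le_div_iff₀ (by positivity)]
            have : L ^ 3 * 10 ^ 6 ≤ L ^ 3 * L := mul_le_mul_of_nonneg_left b3 (by positivity)
            have : 0 ≤ L ^ 3 := by positivity
            nlinarith
        _ ≤ _ := mul_le_mul_of_nonneg_right e2 (by positivity)
    have e4 := mul_le_mul_of_nonneg_left e1 (by positivity : 0 ≤ 1 / (64 * ((M : ℝ) + 41) ^ 2))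
    have h2 : (2 : ℝ) ≤ Real.exp L := by rw [← b5]; linarith
    calc _ ≤ Real.exp (-(2 * L)) := Real.exp_le_exp.2 (by linarith)
      _ = (Real.exp L)⁻¹ * (Real.exp L)⁻¹ := by
          rw [← Real.exp_neg, ← Real.exp_add]; congr 1; ring
      _ ≤ (Real.exp L)⁻¹ * 2⁻¹ := by gcongr
      _ = _ := by rw [← b5]; ring
  linarith

end LowerConst

end BallsBins

end

/-! ### The three processes together -/

theorem mainTheorem7 (Q : BallsBins.AllocProcess)
    (hQ : Q = BallsBins.meanThinning ∨ Q = BallsBins.twinning ∨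
      ∃ (β : NNReal) (_ : 0 < β) (hβ : β < 1), Q = BallsBins.onePlusBeta β hβ.le) :
    (∃ κ : ℝ, 0 < κ ∧ ∃ N : ℕ, ∀ (n : ℕ) [NeZero n], N ≤ n →
      1 - (n : ℝ)⁻¹ ≤ BallsBins.gapProb Q n ⌊κ * n * Real.log n⌋₊
        (fun g => κ * Real.log n ≤ g)) ∧
    (∃ K : ℝ, 0 < K ∧ ∃ N : ℕ, ∀ (n : ℕ) [NeZero n], N ≤ n → ∀ m : ℕ,
      1 - ((n : ℝ) ^ 4)⁻¹ ≤ BallsBins.gapProb Q n m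
        (fun g => g ≤ K * Real.log n)) := by
  rcases hQ with rfl | rfl | ⟨β, hβ0, hβ, rfl⟩
  · exact ⟨BallsBins.lower_bound_meanThinning, BallsBins.upper_bound_of_meanBiased
      BallsBins.represents_meanThinning BallsBins.meanBiased_thinning⟩
  · exact ⟨BallsBins.lower_bound_twinning, BallsBins.upper_bound_of_meanBiased
      BallsBins.represents_twinning BallsBins.meanBiased_twinning⟩
  · exact ⟨BallsBins.lower_bound_onePlusBeta hβ, BallsBins.upper_bound_onePlusBeta hβ0 hβ.le⟩
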